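/- **Fronts.** Legendrian links in $(\mathbb R^3,\ker(dz-y\,dx))$ are given by their front ($xz$-) projections with a Maslov potential $\mu$ (at a cusp the upper strand has potential one larger than the lower one). **The knots.** Let $g\ge 1$, $p\ge 0$. Divide the plane into unit tiles; the tile in column $c$ and row $r$ is $[c-1,c]\times[r-1,r]$, and it is shaded iff $c+r$ is even. Consider the following shaded tiles: those with $1\le c\le 2g+2$, $1\le r\le 4$; those in column $2$ and rows $0,-2,\dots,-2(p-1)$ ($p$ tiles); and those in columns $1$ and $3$ and rows $-1,-3,\dots,-(2p-3)$ ($p-1$ tiles in each of the two columns, none if $p\le 1$). Replace the left (right) edge of each of these tiles by a left (right) cusp; at every vertex that is shared by two of these tiles put a crossing, and smooth all the other corners. Moreover, cut each of the $p$ tiles in column $2$ and rows $0,-2,\dots,-2(p-1)$ into a left piece, ending in a right cusp, and a right piece, starting with a left cusp, and clasp these two facing cusps: the two pieces overlap in a region bounded by the two cusps, with one crossing of their upper strands and one crossing of their lower strands. The bottom and the top edge of a tile in row $r$ get the Maslov potentials $r-1$ and $r$. The result is the front, with a Maslov potential, of the *clasped checkerboard Legendrian knot* $\Lambda_g^p$.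 ($\Lambda_g^0$ is the checkerboard knot of the $(2g+2)\times4$ checkerboard; $\Lambda_g^p$ arises from it by $4p-2$ downward Reidemeister I moves and $p$ clasps for $p\ge 1$.) **The DGA.** $(\mathcal A(\Lambda),\partial)$ is the Chekanov–Eliashberg DGA of $\Lambda$ over $\mathbb Z_2$, computed from the Lagrangian projection that is the resolution of the front: $\mathcal A(\Lambda)$ is the free unital noncommutative algebra on the Reeb chords, one for each crossing and one for each right cusp of the front. A chord at a right cusp has degree $1$; the degree of a chord at a crossing is $\mu$ of the strand of smaller slope minus $\mu$ of the other strand. The differential is the derivation for which $\partial a$ is the sum, over all orientation preserving immersed disks (up to reparametrization) with boundary on the Lagrangian projection, convex corners, and exactly one positive corner, which is at $a$, of the word of their negative corners. An augmentation to $\mathbb Z_2$ is a morphism of DGAs $\epsilon:(\mathcal A(\Lambda),\partial)\to(\mathbb Z_2,0)$, where $\mathbb Z_2$ is in degree $0$: a unital algebra homomorphism with $\epsilon\circ\partial=0$ that vanishes on all chords of nonzero degree. $Aug(\Lambda;\mathbb Z_2)$ is the set of augmentations. **Equivalence.** For a knot $\Lambda$ with one base point $t$, the augmentation category $\mathcal{A}ug_+(\Lambda)$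 has as objects the augmentations; $Hom_+(\epsilon^1,\epsilon^2)$ has the basis $a^{12}$ (one for each Reeb chord $a$, of degree $|a|+1$), $x^{12}$ (degree $1$) and $y^{12}$ (degree $0$). Let the differential of the DGA of the $n$-copy of $\Lambda$ be written in matrices of generators $A=(a^{ij})$ for each chord $a$, $X$ (upper unitriangular, entries $x^{ij}$), $Y$ (strictly upper triangular, entries $y^{ij}$) as $\partial A=\Phi(\partial a)+YA+AY$, $\partial X=YX+XY$, $\partial Y=Y^2$, where $\partial a$ records the passages of disk boundaries through the base point, $\Phi$ is multiplicative with $\Phi(a)=A$, $\Phi(t)=X$, and the base points of the copies are set to $1$. Then $m_1(b)$, resp. $m_2(c,b)$, is the sum over the generators $s$ of $s^{12}$, resp. $s^{13}$, times the coefficient of $b^{12}$ in $\partial s^{12}$, resp. of $b^{12}c^{23}$ in $\partial s^{13}$, after replacing $a^{ii}$ by $a^{ii}+\epsilon^i(a)$. Two augmentations are equivalent, $\epsilon^1\sim\epsilon^2$, if they are isomorphic in the cohomology category: there are degree $0$ cocycles $\alpha\in Hom_+(\epsilon^1,\epsilon^2)$, $\beta\in Hom_+(\epsilon^2,\epsilon^1)$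 with $[m_2(\alpha,\beta)]=[y^{12}]$ in $H^0Hom_+(\epsilon^2,\epsilon^2)$ and $[m_2(\beta,\alpha)]=[y^{12}]$ in $H^0Hom_+(\epsilon^1,\epsilon^1)$. **Lemma.** For all integers $g\ge 1$ and $p\ge 0$, the diagram just described is a well-formed closed front with a Maslov potential, $\sim$ is an equivalence relation on $Aug(\Lambda_g^p;\mathbb Z_2)$, and $$|Aug(\Lambda_g^p;\mathbb Z_2)/\!\sim| = 3^p .$$ -/

import Mathlib

/-!
Front diagrams of Legendrian links in `ℝ³` with contact form `dz - y dx`, the Chekanov–Eliashberg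
DGA over `ℤ/2` of (the resolution of) a front, augmentations to `ℤ/2`, the part of the augmentation
category `Aug₊` that decides when two augmentations are isomorphic in its cohomology category, and
the clasped checkerboard Legendrian knots.
-/

namespace LegendrianFront

/-- The elementary events met when a generic front is swept by a vertical line from left to right.
The strands met by the line are numbered `0, 1, 2, …` from bottom to top.
* `leftCusp k m`: a left cusp creates the strands `k` (Maslov potential `m`) and `k + 1`
  (Maslov potential `m + 1`); the strands that were at `k` and above move up by two;
* `crossing k`: the strands `k` and `k + 1` cross;
* `rightCusp k`: the strands `k` and `k + 1` end in a right cusp; the strands above move down. -/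
inductive Event where
  | leftCusp (k : ℕ) (m : ℤ)
  | crossing (k : ℕ)
  | rightCusp (k : ℕ)
  deriving DecidableEq

/-- A front decorated with a Maslov potential: the list of its events, from left to right. -/
abbrev Front := List Event

/-- Effect of an event on the list of the Maslov potentials of the strands (bottom to top). -/
def Event.step (e : Event) (s : List ℤ) : List ℤ :=
  match e with
  | .leftCusp k m => s.take k ++ [m, m + 1] ++ s.drop k
  | .crossing k => s.take k ++ [s.getD (k + 1) 0, s.getD k 0] ++ s.drop (k + 2)
  | .rightCusp k => s.take k ++ s.drop (k + 2)

/-- The event can take place when the strands have the Maslov potentials `s`. At a cusp the upper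
strand has to have a potential one larger than the lower strand. -/
def Event.Allowed (e : Event) (s : List ℤ) : Prop :=
  match e with
  | .leftCusp k _ => k ≤ s.length
  | .crossing k => k + 1 < s.length
  | .rightCusp k => k + 1 < s.length ∧ s.getD (k + 1) 0 = s.getD k 0 + 1

/-- The Maslov potentials of the strands (bottom to top) just before event number `n`. -/
def Front.potentials (F : Front) (n : ℕ) : List ℤ :=
  (F.take n).foldl (fun s e => e.step s) []

/-- `F` is the front of a closed Legendrian link with a Maslov potential: every event is possible
where it occurs, and no strand is left over on the right. -/
def Front.IsClosed (F : Front) : Prop :=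
  (∀ n : Fin F.length, (F.get n).Allowed (F.potentials n)) ∧ F.potentials F.length = []

/-! ### Reeb chords and their degrees -/

/-- In the resolution of a front every crossing and every right cusp yields a double point of the
Lagrangian projection, i.e. a Reeb chord. -/
def Event.IsChord : Event → Bool
  | .leftCusp _ _ => false
  | .crossing _ => true
  | .rightCusp _ => true

/-- The Reeb chords of (the resolution of) the front `F`. -/
abbrev Front.Chord (F : Front) := {n : Fin F.length // (F.get n).IsChord = true}

/-- The degree `|c| = CZ(c) - 1`: at a crossing it is the Maslov potential of the strand of smaller
slope (the one that is on top to the left of the crossing) minus the potential of the other strand;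
at a right cusp it is `1`. -/
def Front.degree (F : Front) (c : F.Chord) : ℤ :=
  match F.get c.1 with
  | .leftCusp _ _ => 0
  | .crossing k => (F.potentials c.1).getD (k + 1) 0 - (F.potentials c.1).getD k 0
  | .rightCusp _ => 1

/-! ### The disks of the Chekanov–Eliashberg differential

The Lagrangian projection of the resolution of a front has a left turn `⊂` for each left cusp, a
double point for each crossing, and a double point followed by a right turn `⊃` (a small loop) for
each right cusp. At a double point the positive Reeb quadrants are the left and the right one, the
negative Reeb quadrants are the upper and the lower one.

The differential counts orientation preserving immersions of polygons in this planar diagram, up to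
reparametrisation, whose corners are convex, exactly one of them at a positive quadrant.
The preimage under such an immersion of a vertical line is a disjoint union of arcs, each of which
is mapped homeomorphically onto the vertical segment between two strands. Going from right to left,
such an arc moves with its end points. It can start only at the positive corner (a left quadrant);
the single exception is the small loop of a right cusp, which is itself an immersed monogon with its
positive corner at the right quadrant. It can end only at a left turn. When it sweeps over a right
turn from the right, the polygon either covers it or its boundary goes around it; in the latter case
the arc is cut into two arcs. (An arc never is cut at a left turn, since the two resulting arcs
would both have to close up on the right, at two different positive corners.)
-/

/-- Letters on the boundary of a disk: the Reeb chord given by event number `n`, or the base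
point. -/
inductive Letter where
  | chord (n : ℕ)
  | base
  deriving DecidableEq

/-- Let `w` be the list of the events to the left of a vertical line, *from right to left*.
`halfDisks w i j` (for `i < j`) lists the boundary words, one for each disk, of all immersed
half-disks to the left of the line, whose right edge is the segment from strand `i` to strand `j`,
and whose corners are all convex and at negative quadrants. The boundary word is read
counterclockwise, so it starts on strand `j` and ends on strand `i`. The base point `t` sits at the
left turn of the first event, and the link is oriented downwards there. -/
def halfDisks : List Event → ℕ → ℕ → List (List Letter)
  | [], _, _ => []
  | .leftCusp k _ :: w, i, j =>
      if i = k ∧ j = k + 1 then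
        -- the half-disk has its left end at this left turn
        if w = [] then [[.base]] else [[]]
      else if i = k ∨ i = k + 1 ∨ j = k ∨ j = k + 1 then []
      else halfDisks w (if i < k then i else i - 2) (if j < k then j else j - 2)
  | .crossing k :: w, i, j =>
      if i = k ∧ j = k + 1 then []
      else if j = k then
        -- straight through the crossing, or a corner at the lower quadrant
        halfDisks w i (k + 1) ++ (halfDisks w i k).map (fun u => .chord w.length :: u)
      else if j = k + 1 then halfDisks w i k
      else if i = k then halfDisks w (k + 1) j
      else if i = k + 1 then
        -- straight through the crossing, or a corner at the upper quadrant
        halfDisks w k j ++ (halfDisks w (k + 1) j).map (fun u => u ++ [.chord w.length])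
      else halfDisks w i j
  | .rightCusp k :: w, i, j =>
      if j < k then halfDisks w i j
      else if k ≤ i then halfDisks w (i + 2) (j + 2)
      else
        -- either the right turn is covered, or the boundary goes around it; in the latter case each
        -- of the two pieces goes straight through the double point of the loop or has a corner there
        halfDisks w i (j + 2) ++
          (halfDisks w k (j + 2) ++
              (halfDisks w (k + 1) (j + 2)).map (fun u => u ++ [.chord w.length])).flatMap
            (fun u => (halfDisks w i (k + 1) ++
              (halfDisks w i k).map (fun v => .chord w.length :: v)).map (fun v => u ++ v))

/-- The words of negative corners (and passages of the base point), read counterclockwise from the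
positive corner, of all immersed disks whose positive corner is at the chord `c`: one word for each
disk. -/
def Front.disks (F : Front) (c : F.Chord) : List (List Letter) :=
  match F.get c.1 with
  | .leftCusp _ _ => []
  | .crossing k => halfDisks (F.take c.1).reverse k (k + 1)
  | .rightCusp k => [] :: halfDisks (F.take c.1).reverse k (k + 1)

/-- Value of a letter in a ring, given the values `v` of the Reeb chords and `t` of the base
point. (Letters of disks that are not the base point always are Reeb chords.) -/
def Front.evalLetter (F : Front) {R : Type*} [Ring R] (v : F.Chord → R) (t : R) : Letter → R
  | .chord n =>
      if h : ∃ h' : n < F.length, (F.get ⟨n, h'⟩).IsChord = true then v ⟨⟨n, h.1⟩, h.2⟩ else 0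
  | .base => t

/-- The sum over all disks with positive corner `c` of the products along their boundary words. -/
def Front.evalDisks (F : Front) {R : Type*} [Ring R] (v : F.Chord → R) (t : R) (c : F.Chord) : R :=
  ((F.disks c).map (fun u => (u.map (F.evalLetter v t)).prod)).sum

/-! ### The DGA and its augmentations -/

/-- The algebra of the Chekanov–Eliashberg DGA over `ℤ/2`: the free unital noncommutative algebra
on the Reeb chords. -/
abbrev Front.Alg (F : Front) := FreeAlgebra (ZMod 2) F.Chord

/-- The homomorphism `a ↦ (a, ∂ a)` to the square-zero extension of the algebra by itself. -/
noncomputable def Front.differentialAux (F : Front) : F.Alg →ₐ[ZMod 2] TrivSqZeroExt F.Alg F.Alg :=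
  FreeAlgebra.lift (ZMod 2) (fun c : F.Chord =>
    TrivSqZeroExt.inl (FreeAlgebra.ι (ZMod 2) c) +
      TrivSqZeroExt.inr (F.evalDisks (FreeAlgebra.ι (ZMod 2)) 1 c))

/-- The differential: the derivation that maps each Reeb chord `c` to the sum of the words of
negative corners of the disks with positive corner `c`. -/
noncomputable def Front.differential (F : Front) : F.Alg →ₗ[ZMod 2] F.Alg where
  toFun a := (F.differentialAux a).snd
  map_add' a b := by simp
  map_smul' r a := by simp

theorem Front.differentialAux_fst (F : Front) (a : F.Alg) : (F.differentialAux a).fst = a := by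
  have h : (TrivSqZeroExt.fstHom (ZMod 2) F.Alg F.Alg).comp F.differentialAux =
      AlgHom.id (ZMod 2) F.Alg := by
    apply FreeAlgebra.hom_ext
    funext c
    simp [Front.differentialAux]
  exact congrArg (fun f => f a) h

theorem Front.differential_ι (F : Front) (c : F.Chord) :
    F.differential (FreeAlgebra.ι (ZMod 2) c) = F.evalDisks (FreeAlgebra.ι (ZMod 2)) 1 c := by
  simp [Front.differential, Front.differentialAux]

/-- The Leibniz rule (there are no signs over `ℤ/2`). -/
theorem Front.differential_mul (F : Front) (a b : F.Alg) :
    F.differential (a * b) = F.differential a * b + a * F.differential b := by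
  simp [Front.differential, Front.differentialAux_fst, add_comm]

/-- An augmentation to `ℤ/2`: a morphism of DGAs to `ℤ/2`, where `ℤ/2` is placed in degree `0` and
has differential `0`. -/
structure Augmentation (F : Front) where
  toAlgHom : F.Alg →ₐ[ZMod 2] ZMod 2
  map_degree : ∀ c : F.Chord, F.degree c ≠ 0 → toAlgHom (FreeAlgebra.ι (ZMod 2) c) = 0
  map_differential : ∀ a : F.Alg, toAlgHom (F.differential a) = 0

/-- Value of an augmentation on a Reeb chord. -/
def Augmentation.val {F : Front} (ε : Augmentation F) (c : F.Chord) : ZMod 2 :=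
  ε.toAlgHom (FreeAlgebra.ι (ZMod 2) c)

/-! ### The augmentation category of a knot -/

/-- Generators of the morphism spaces of `Aug₊`: the mixed chords of the `2`-copy from one copy to
the other one, i.e. a chord `a¹²` for each Reeb chord `a`, and the Morse chords `x¹²`, `y¹²` near
the base point, which come from the maximum and the minimum of the perturbing Morse function. -/
inductive Gen (F : Front) where
  | chord (c : F.Chord)
  | x
  | y

/-- The (shifted) degree of the generators of the morphism spaces. -/
def Gen.degree {F : Front} : Gen F → ℤ
  | .chord c => F.degree c + 1
  | .x => 1
  | .y => 0

/-- The module `Hom₊(ε¹, ε²)`, which as a module does not depend on `ε¹, ε²`. -/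
abbrev HomPlus (F : Front) := Gen F → ZMod 2

/-- `α` is homogeneous of degree `d`. -/
def IsHomogeneous {F : Front} (d : ℤ) (α : HomPlus F) : Prop := ∀ s, α s ≠ 0 → s.degree = d

/-- The differential of the DGA of the `n`-copy of a knot: if the generators `aⁱʲ`, `xⁱʲ`, `yⁱʲ` are
assembled into matrices `A a`, `X` (upper triangular with ones on the diagonal), `Y` (strictly upper
triangular), and the base points `tⁱ` are set to `1`, then
`∂ A = Φ(∂ a) + Y A + A Y`, `∂ X = Y X + X Y`, `∂ Y = Y²`, where `Φ(a) = A a` and `Φ(t) = X`. -/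
def copyDifferential (F : Front) {n : ℕ} (A : F.Chord → Matrix (Fin n) (Fin n) (ZMod 2))
    (X Y : Matrix (Fin n) (Fin n) (ZMod 2)) : Gen F → Matrix (Fin n) (Fin n) (ZMod 2)
  | .chord c => F.evalDisks A X c + Y * A c + A c * Y
  | .x => Y * X + X * Y
  | .y => Y * Y

/-- `m₁ : Hom₊(ε¹, ε²) → Hom₊(ε¹, ε²)`. The coefficient of `b¹²` in the differential of `s¹²` in the
`2`-copy, twisted by `ε¹, ε²`, is read off by giving the pure chords `aⁱⁱ` the values `εⁱ a`. -/
def mOne {F : Front} (ε₁ ε₂ : Augmentation F) (α : HomPlus F) : HomPlus F := fun s =>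
  copyDifferential F (fun c => !![ε₁.val c, α (.chord c); 0, ε₂.val c])
    !![1, α .x; 0, 1] !![0, α .y; 0, 0] s 0 1

/-- `m₂ : Hom₊(ε², ε³) ⊗ Hom₊(ε¹, ε²) → Hom₊(ε¹, ε³)`, from the coefficients of `b¹² c²³` in the
differential of `s¹³` in the `3`-copy, twisted by `ε¹, ε², ε³`. -/
def mTwo {F : Front} (ε₁ ε₂ ε₃ : Augmentation F) (β α : HomPlus F) : HomPlus F := fun s =>
  copyDifferential F
    (fun c => !![ε₁.val c, α (.chord c), 0; 0, ε₂.val c, β (.chord c); 0, 0, ε₃.val c])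
    !![1, α .x, 0; 0, 1, β .x; 0, 0, 1] !![0, α .y, 0; 0, 0, β .y; 0, 0, 0] s 0 2

/-- The unit `-y¹² = y¹²` of `Hom₊(ε, ε)`. -/
def homUnit (F : Front) : HomPlus F
  | .y => 1
  | _ => 0

/-- `α` is a cocycle of degree `0` in `Hom₊(ε¹, ε²)`. -/
def IsCocycle {F : Front} (ε₁ ε₂ : Augmentation F) (α : HomPlus F) : Prop :=
  IsHomogeneous 0 α ∧ mOne ε₁ ε₂ α = 0

/-- `α` and `β`, of degree `0` in `Hom₊(ε¹, ε²)`, differ by a coboundary. -/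
def Cohomologous {F : Front} (ε₁ ε₂ : Augmentation F) (α β : HomPlus F) : Prop :=
  ∃ γ : HomPlus F, IsHomogeneous (-1) γ ∧ α - β = mOne ε₁ ε₂ γ

/-- Equivalence of augmentations: being isomorphic in the cohomology category of `Aug₊`. -/
def AugEquiv (F : Front) (ε₁ ε₂ : Augmentation F) : Prop :=
  ∃ α β : HomPlus F, IsCocycle ε₁ ε₂ α ∧ IsCocycle ε₂ ε₁ β ∧
    Cohomologous ε₂ ε₂ (mTwo ε₂ ε₁ ε₂ α β) (homUnit F) ∧
    Cohomologous ε₁ ε₁ (mTwo ε₁ ε₂ ε₁ β α) (homUnit F)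

/-! ### The clasped checkerboard knots

Rows and columns of the tiles of the plane are numbered such that the checkerboard consists of the
columns `1, …, 2g + 2` and the rows `1, …, 4`; the tile in row `r` lies between the heights `r - 1`
and `r`, and it is shaded iff column plus row is even. -/

/-- The rows, from bottom to top, of the shaded tiles in column `c` that are used for `Λ_g^p`: the
shaded tiles of the `(2g + 2) × 4` checkerboard, and below it the tiles in the rows
`0, -2, …, -2(p - 1)` of column `2` (these carry the clasps) and in the rows
`-1, -3, …, -(2p - 3)` of the columns `1` and `3`. -/
def tileRows (g p c : ℕ) : List ℤ :=
  if c = 0 ∨ 2 * g + 2 < c then []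
  else if c = 2 then (List.range p).reverse.map (fun j => -(2 * (j : ℤ))) ++ [2, 4]
  else if c = 1 ∨ c = 3 then (List.range (p - 1)).reverse.map (fun j => -(2 * (j : ℤ) + 1)) ++ [1, 3]
  else if c % 2 = 1 then [1, 3]
  else [2, 4]

/-- Number of the tiles of a column that are below row `r`. -/
def tilesBelow (l : List ℤ) (r : ℤ) : ℕ := l.countP (fun s => decide (s < r))

/-- The events at the vertical grid line between two columns, with tiles in the rows `old` (left)
and `new` (right): the left edges of the new tiles become left cusps, then there is a crossing at
each vertex that an old and a new tile share, and then the right edges of the old tiles become right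
cusps. The strands on the bottom and on the top edge of the tile in row `r` have the Maslov
potentials `r - 1` and `r`. -/
def gridLine (old new : List ℤ) : Front :=
  new.map (fun r => .leftCusp (2 * (tilesBelow old r + tilesBelow new r)) (r - 1)) ++
  new.flatMap (fun r =>
    (if r - 1 ∈ old then [.crossing (2 * (tilesBelow old r + tilesBelow new r) - 1)] else []) ++
    (if r + 1 ∈ old then [.crossing (2 * (tilesBelow old r + tilesBelow new r) + 1)] else [])) ++
  old.map (fun r => .rightCusp (2 * tilesBelow new r))

/-- A clasp inside the tile in row `r` whose bottom and top edges are the strands `q` and `q + 1`: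
the tile is cut into a left piece, which ends in a right cusp, and a right piece, which starts with
a left cusp, and these two cusps are clasped. -/
def clasp (q : ℕ) (r : ℤ) : Front :=
  [.leftCusp (q + 1) (r - 1), .crossing q, .crossing (q + 2), .rightCusp (q + 1)]

/-- The front of the clasped checkerboard Legendrian `Λ_g^p`; for `p = 0` it is the checkerboard
Legendrian `Λ_g^0`. The `p` clasps are in the `p` lowest tiles of column `2`. -/
def claspedCheckerboard (g p : ℕ) : Front :=
  (List.range (2 * g + 3)).flatMap (fun c =>
    gridLine (tileRows g p c) (tileRows g p (c + 1)) ++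
      if c = 1 then
        (List.range p).flatMap (fun s => clasp (2 * s) (-(2 * ((p : ℤ) - 1 - (s : ℤ)))))
      else [])

end LegendrianFront

/-!
All crossings of the front of `Λ_g^p` join strands of equal Maslov potential, so the Reeb chords have
the degrees `0` (crossings) and `1` (right cusps). Hence `Hom₊` is spanned by `y¹²` in degree `0` and
vanishes in degree `-1`, and `m₁ (y¹²)` is the sum of the generators `c¹²` with `ε¹ c ≠ ε² c`. So two
augmentations are equivalent only if they are equal (`augEquiv_iff_eq`), and it remains to count
augmentations, i.e. the values of the crossings in `ℤ/2` for which `∂ c = 0` at all right cusps `c`.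

This is done by sweeping the front from left to right. Let `M i j` be the sum, over the half-disks
to the left of a vertical line with right edge from strand `i` to strand `j`, of the products of the
values of their corners. An event with value `u` changes `M` by `Event.stepMatrix`, a right cusp of
the strands `k`, `k + 1` requires `M k (k + 1) = 1`, and the number of augmentations becomes a
recursion `count` over the events (`card_augmentation`).

Between two grid lines `M` always is `pairing N`: the only half-disks that count are those between
the bottom and the top edge of the same tile. A grid line adds new pairs, lets neighbouring pairs
cross, and closes the old pairs. Since a right cusp commutes with the crossings above it, each old
tile can be closed as soon as its own right vertices have been passed. The right cusp of a tile
requires the product of the values of its crossings to be `1`, so that all these crossings have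
the value `1`, and what is left is a pairing again (`count_pairing_bottom`, `count_pairing_middle`,
`count_pairing_top`). At a clasp with crossings `u`, `v` the equation is `1 + u * v = 1`, which has
three solutions, and the pairing comes back unchanged (`count_pairing_clasp`). Thus the `p` clasps
contribute `3 ^ p`, and everything else contributes `1`.
-/

namespace LegendrianFront

/-! ### Augmentations as solutions of polynomial equations -/

theorem Front.evalLetter_map (F : Front) {R S : Type*} [Ring R] [Ring S] (f : R →+* S)
    (v : F.Chord → R) (t : R) (l : Letter) :
    F.evalLetter (fun c => f (v c)) (f t) l = f (F.evalLetter v t l) := by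
  cases l with
  | base => rfl
  | chord n =>
    simp only [Front.evalLetter]
    split_ifs <;> simp

theorem Front.evalDisks_map (F : Front) {R S : Type*} [Ring R] [Ring S] (f : R →+* S)
    (v : F.Chord → R) (t : R) (c : F.Chord) :
    F.evalDisks (fun c => f (v c)) (f t) c = f (F.evalDisks v t c) := by
  simp only [Front.evalDisks, map_list_sum, List.map_map, Function.comp_def, map_list_prod]
  congr 1
  refine List.map_congr_left fun u _ => ?_
  congr 1
  exact List.map_congr_left fun l _ => F.evalLetter_map f v t l

/-- If all pure chords of the `n`-copy have scalar values and the mixed ones vanish, then so do the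
mixed parts of all disk counts. -/
theorem Front.evalDisks_diagonal (F : Front) {n : ℕ} (d : F.Chord → Fin n → ZMod 2)
    (c : F.Chord) {i j : Fin n} (h : i ≠ j) :
    F.evalDisks (fun c => Matrix.diagonal (d c)) 1 c i j = 0 := by
  have := F.evalDisks_map (Matrix.diagonalRingHom (Fin n) (ZMod 2)) d 1 c
  rw [map_one] at this
  simp only [Matrix.diagonalRingHom_apply] at this
  rw [this]
  exact Matrix.diagonal_apply_ne _ h

theorem Augmentation.ext_val {F : Front} {ε₁ ε₂ : Augmentation F} (h : ∀ c, ε₁.val c = ε₂.val c) :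
    ε₁ = ε₂ := by
  have : ε₁.toAlgHom = ε₂.toAlgHom := by
    apply FreeAlgebra.hom_ext
    funext c
    exact h c
  cases ε₁
  cases ε₂
  simpa using this

theorem Augmentation.evalDisks_val {F : Front} (ε : Augmentation F) (c : F.Chord) :
    F.evalDisks ε.val 1 c = 0 := by
  have h := ε.map_differential (FreeAlgebra.ι (ZMod 2) c)
  rw [Front.differential_ι] at h
  rw [← h]
  have := F.evalDisks_map ε.toAlgHom.toRingHom (FreeAlgebra.ι (ZMod 2)) 1 c
  rw [map_one] at this
  exact this

/-- The augmentations are the common zeros, among the valuations supported in degree `0`, of the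
polynomials `∂ c`. -/
def augmentationEquiv (F : Front) : Augmentation F ≃
    {v : F.Chord → ZMod 2 // (∀ c, F.degree c ≠ 0 → v c = 0) ∧ ∀ c, F.evalDisks v 1 c = 0} where
  toFun ε := ⟨ε.val, ε.map_degree, ε.evalDisks_val⟩
  invFun v :=
    { toAlgHom := FreeAlgebra.lift (ZMod 2) v.1
      map_degree := fun c hc => by simpa using v.2.1 c hc
      map_differential := fun a => by
        induction a using FreeAlgebra.induction with
        | grade0 r =>
          have : F.differential (algebraMap (ZMod 2) F.Alg r) = 0 := by
            change (F.differentialAux (algebraMap (ZMod 2) F.Alg r)).snd = 0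
            rw [AlgHom.commutes, TrivSqZeroExt.algebraMap_eq_inl', TrivSqZeroExt.snd_inl]
          rw [this, map_zero]
        | grade1 c =>
          rw [Front.differential_ι]
          refine Eq.trans ?_ (v.2.2 c)
          have := F.evalDisks_map (FreeAlgebra.lift (ZMod 2) v.1).toRingHom
            (FreeAlgebra.ι (ZMod 2)) 1 c
          rw [map_one] at this
          simpa using this.symm
        | mul a b ha hb => rw [Front.differential_mul]; simp [ha, hb]
        | add a b ha hb => simp [ha, hb] }
  left_inv ε := Augmentation.ext_val fun c => by simp [Augmentation.val]
  right_inv v := by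
    apply Subtype.ext
    funext c
    simp [Augmentation.val]

/-! ### Equivalence of augmentations in nonnegative degree -/

theorem two_copy_diagonal (a b : ZMod 2) : !![a, 0; 0, b] = Matrix.diagonal ![a, b] := by
  ext i j
  fin_cases i <;> fin_cases j <;> simp

theorem three_copy_diagonal (a b c : ZMod 2) :
    !![a, 0, 0; 0, b, 0; 0, 0, c] = Matrix.diagonal ![a, b, c] := by
  ext i j
  fin_cases i <;> fin_cases j <;> simp

/-- On a multiple of `y¹²`, the operation `m₁` measures the difference of the augmentations. -/
theorem mOne_eq {F : Front} (ε₁ ε₂ : Augmentation F) (α : HomPlus F)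
    (hc : ∀ c, α (.chord c) = 0) (hx : α .x = 0) (s : Gen F) :
    mOne ε₁ ε₂ α s = match s with
      | .chord c => α .y * (ε₂.val c + ε₁.val c)
      | .x => 0
      | .y => 0 := by
  have h1 : (!![1, 0; 0, 1] : Matrix (Fin 2) (Fin 2) (ZMod 2)) = 1 := by
    rw [two_copy_diagonal]; ext i j; fin_cases i <;> fin_cases j <;> simp
  cases s with
  | chord c =>
    simp only [mOne, copyDifferential, hc, hx, h1]
    simp only [Matrix.add_apply, two_copy_diagonal]
    rw [F.evalDisks_diagonal _ c (by decide)]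
    simp [Matrix.mul_apply, Fin.sum_univ_two]
    ring
  | x =>
    simp only [mOne, copyDifferential, hx, h1, mul_one, one_mul, Matrix.add_apply]
    simp [CharTwo.add_self_eq_zero]
  | y => simp [mOne, copyDifferential, Matrix.mul_apply, Fin.sum_univ_two]

theorem mTwo_eq {F : Front} (ε₁ ε₂ ε₃ : Augmentation F) (β α : HomPlus F)
    (hc : ∀ c, α (.chord c) = 0) (hx : α .x = 0)
    (hc' : ∀ c, β (.chord c) = 0) (hx' : β .x = 0) :
    mTwo ε₁ ε₂ ε₃ β α = (α .y * β .y) • homUnit F := by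
  have h1 : (!![1, 0, 0; 0, 1, 0; 0, 0, 1] : Matrix (Fin 3) (Fin 3) (ZMod 2)) = 1 := by
    rw [three_copy_diagonal]; ext i j; fin_cases i <;> fin_cases j <;> simp
  funext s
  cases s with
  | chord c =>
    simp only [mTwo, copyDifferential, hc, hx, hc', hx', h1]
    simp only [Matrix.add_apply, three_copy_diagonal]
    rw [F.evalDisks_diagonal _ c (by decide)]
    simp [Matrix.mul_apply, Fin.sum_univ_three, homUnit]
  | x =>
    simp only [mTwo, copyDifferential, hx, hx', h1, mul_one, one_mul, Matrix.add_apply]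
    simp [homUnit]
  | y => simp [mTwo, copyDifferential, Matrix.mul_apply, Fin.sum_univ_three, homUnit]

/-- If no Reeb chord has negative degree, then `Hom₊` is spanned by `y¹²` in degree `0` and vanishes
in degree `-1`; hence only equal augmentations are equivalent. -/
theorem augEquiv_iff_eq {F : Front} (hF : ∀ c : F.Chord, 0 ≤ F.degree c) (ε₁ ε₂ : Augmentation F) :
    AugEquiv F ε₁ ε₂ ↔ ε₁ = ε₂ := by
  have hom0 : ∀ α : HomPlus F, IsHomogeneous 0 α → (∀ c, α (.chord c) = 0) ∧ α .x = 0 := by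
    refine fun α hα => ⟨fun c => ?_, ?_⟩
    · by_contra h
      have h1 := hα _ h
      have h2 := hF c
      simp only [Gen.degree] at h1
      omega
    · by_contra h
      exact absurd (hα _ h) (by simp [Gen.degree])
  have hom1 : ∀ γ : HomPlus F, IsHomogeneous (-1) γ → γ = 0 := by
    intro γ hγ
    funext s
    by_contra h
    have h1 := hγ _ h
    cases s with
    | chord c =>
      have h2 := hF c
      simp only [Gen.degree] at h1
      omega
    | x => simp [Gen.degree] at h1
    | y => simp [Gen.degree] at h1
  constructor
  · rintro ⟨α, β, ⟨hα, hα'⟩, ⟨hβ, -⟩, ⟨γ, hγ, h⟩, -⟩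
    obtain ⟨hαc, hαx⟩ := hom0 α hα
    obtain ⟨hβc, hβx⟩ := hom0 β hβ
    rw [mTwo_eq _ _ _ _ _ hβc hβx hαc hαx, hom1 γ hγ] at h
    have hy := congrFun h .y
    -- The `y`-component reads `α .y * β .y = 1`, because coboundaries of degree `0` vanish.
    rw [mOne_eq _ _ _ (fun _ => rfl) rfl] at hy
    simp only [Pi.sub_apply, Pi.smul_apply, homUnit, smul_eq_mul, mul_one, sub_eq_zero] at hy
    have hαy : α .y = 1 := by
      revert hy
      generalize α .y = a
      generalize β .y = b
      revert a b
      decide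
    refine Augmentation.ext_val fun c => ?_
    have hc := congrFun hα' (.chord c)
    rw [mOne_eq _ _ _ hαc hαx] at hc
    simp only [hαy, one_mul, Pi.zero_apply] at hc
    exact (CharTwo.add_eq_zero.mp hc).symm
  · rintro rfl
    have hu : IsCocycle ε₁ ε₁ (homUnit F) := by
      refine ⟨fun s hs => ?_, ?_⟩
      · cases s with
        | chord c => simp [homUnit] at hs
        | x => simp [homUnit] at hs
        | y => rfl
      · funext s
        rw [mOne_eq _ _ _ (fun _ => rfl) rfl]
        cases s <;> simp [CharTwo.add_self_eq_zero]
    have hm : Cohomologous ε₁ ε₁ (mTwo ε₁ ε₁ ε₁ (homUnit F) (homUnit F)) (homUnit F) := by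
      refine ⟨0, fun s hs => absurd rfl hs, ?_⟩
      funext s
      rw [mTwo_eq _ _ _ _ _ (fun _ => rfl) rfl (fun _ => rfl) rfl,
        mOne_eq _ _ _ (fun _ => rfl) rfl]
      cases s <;> simp [homUnit]
    exact ⟨_, _, hu, hu, hm, hm⟩


/-! ### Sweeping the disks from left to right -/

/-- Evaluation of letters in `ℤ/2`: `f n` is the value of the Reeb chord at event number `n`, and
the base point has value `1`. -/
def letterVal (f : ℕ → ZMod 2) : Letter → ZMod 2
  | .chord n => f n
  | .base => 1

/-- The value of a list of boundary words. -/
def wordSum (f : ℕ → ZMod 2) (l : List (List Letter)) : ZMod 2 :=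
  (l.map (fun u => (u.map (letterVal f)).prod)).sum

/-- The strictly upper triangular matrix of the evaluated counts of half-disks to the left of a
vertical line, where `w` lists the events to the left of this line from right to left. The entries
on and below the diagonal, where `halfDisks` has no meaning, are set to `0`. -/
def diskMatrix (f : ℕ → ZMod 2) (w : List Event) : ℕ → ℕ → ZMod 2 := fun i j =>
  if i < j then wordSum f (halfDisks w i j) else 0

/-- The effect on the half-disk matrix of an event whose Reeb chord, if there is one, has the
value `u`; this is the recursion of `halfDisks` after evaluation. -/
def Event.stepMatrix (e : Event) (u : ZMod 2) (M : ℕ → ℕ → ZMod 2) : ℕ → ℕ → ZMod 2 := fun i j =>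
  if i < j then
    match e with
    | .leftCusp k _ =>
        if i = k ∧ j = k + 1 then 1
        else if i = k ∨ i = k + 1 ∨ j = k ∨ j = k + 1 then 0
        else M (if i < k then i else i - 2) (if j < k then j else j - 2)
    | .crossing k =>
        if i = k ∧ j = k + 1 then 0
        else if j = k then M i (k + 1) + u * M i k
        else if j = k + 1 then M i k
        else if i = k then M (k + 1) j
        else if i = k + 1 then M k j + u * M (k + 1) j
        else M i j
    | .rightCusp k =>
        if j < k then M i j
        else if k ≤ i then M (i + 2) (j + 2)
        else M i (j + 2) + (M k (j + 2) + u * M (k + 1) (j + 2)) * (M i (k + 1) + u * M i k)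
  else 0

theorem wordSum_append (f : ℕ → ZMod 2) (l l' : List (List Letter)) :
    wordSum f (l ++ l') = wordSum f l + wordSum f l' := by
  simp [wordSum]

theorem wordSum_map_cons (f : ℕ → ZMod 2) (n : ℕ) (l : List (List Letter)) :
    wordSum f (l.map (fun u => .chord n :: u)) = f n * wordSum f l := by
  simp [wordSum, Function.comp_def, List.sum_map_mul_left, letterVal]

theorem wordSum_map_concat (f : ℕ → ZMod 2) (n : ℕ) (l : List (List Letter)) :
    wordSum f (l.map (fun u => u ++ [.chord n])) = f n * wordSum f l := by
  simp [wordSum, Function.comp_def, List.sum_map_mul_right, letterVal, mul_comm (f n)]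

theorem wordSum_flatMap (f : ℕ → ZMod 2) (l l' : List (List Letter)) :
    wordSum f (l.flatMap (fun u => l'.map (fun v => u ++ v))) = wordSum f l * wordSum f l' := by
  induction l with
  | nil => simp [wordSum]
  | cons u l ih =>
    rw [List.flatMap_cons, wordSum_append, ih]
    simp [wordSum, Function.comp_def, List.sum_map_mul_left, add_mul]

theorem diskMatrix_nil (f : ℕ → ZMod 2) : diskMatrix f [] = fun _ _ => 0 := by
  funext i j
  simp [diskMatrix, halfDisks, wordSum]

theorem diskMatrix_cons (f : ℕ → ZMod 2) (e : Event) (w : List Event) :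
    diskMatrix f (e :: w) = e.stepMatrix (f w.length) (diskMatrix f w) := by
  funext i j
  by_cases hij : i < j
  swap
  · simp [diskMatrix, Event.stepMatrix, hij]
  simp only [diskMatrix, Event.stepMatrix, hij, if_true]
  cases e with
  | leftCusp k m =>
    simp only [halfDisks]
    split_ifs <;> first | omega | simp [wordSum, letterVal]
  | crossing k =>
    simp only [halfDisks]
    split_ifs <;>
      first
        | omega
        | rfl
        | rw [wordSum_append, wordSum_map_cons]
        | rw [wordSum_append, wordSum_map_concat]
  | rightCusp k =>
    simp only [halfDisks]
    split_ifs <;> first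
      | omega
      | rfl
      | rw [wordSum_append, wordSum_flatMap, wordSum_append, wordSum_append, wordSum_map_concat,
          wordSum_map_cons]

/-! ### Counting augmentations by a recursion over the events -/

/-- The conditions on an augmentation at an event, if `M` is the half-disk matrix to the left of it:
the value `u` of the event is `0` unless it is a crossing, and the differential of its Reeb chord is
mapped to `0`. At a right cusp the small loop contributes the summand `1` to the differential. -/
def Event.Admits (e : Event) (u : ZMod 2) (M : ℕ → ℕ → ZMod 2) : Prop :=
  match e with
  | .leftCusp _ _ => u = 0
  | .crossing k => M k (k + 1) = 0
  | .rightCusp k => u = 0 ∧ M k (k + 1) = 1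

/-- `f` gives admissible values to the events of `F`, and `0` beyond the end of `F`, if `M` is the
half-disk matrix to the left of `F`. -/
def Admissible : (ℕ → ℕ → ZMod 2) → List Event → (ℕ → ZMod 2) → Prop
  | _, [], f => ∀ n, f n = 0
  | M, e :: F, f => e.Admits (f 0) M ∧ Admissible (e.stepMatrix (f 0) M) F (fun n => f (n + 1))

open Classical in
/-- The number of admissible valuations of the events of `F`. -/
noncomputable def count : (ℕ → ℕ → ZMod 2) → List Event → ℕ
  | _, [] => 1
  | M, e :: F => ∑ u : ZMod 2, if e.Admits u M then count (e.stepMatrix u M) F else 0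

/-- The first value of an admissible valuation and the remaining ones. -/
def admissibleConsEquiv (M : ℕ → ℕ → ZMod 2) (e : Event) (F : List Event) :
    {f // Admissible M (e :: F) f} ≃
      Σ u : ZMod 2, {f // e.Admits u M ∧ Admissible (e.stepMatrix u M) F f} where
  toFun f := ⟨f.1 0, fun n => f.1 (n + 1), f.2⟩
  invFun x := ⟨fun
    | 0 => x.1
    | n + 1 => x.2.1 n, x.2.2⟩
  left_inv f := by
    apply Subtype.ext
    funext n
    cases n <;> rfl
  right_inv x := rfl

theorem finite_admissible (M : ℕ → ℕ → ZMod 2) (F : List Event) :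
    Finite {f // Admissible M F f} := by
  induction F generalizing M with
  | nil =>
    have : Subsingleton {f // Admissible M [] f} :=
      ⟨fun f g => Subtype.ext (funext fun n => (f.2 n).trans (g.2 n).symm)⟩
    infer_instance
  | cons e F ih =>
    have (u : ZMod 2) : Finite {f // e.Admits u M ∧ Admissible (e.stepMatrix u M) F f} :=
      Set.Finite.subset (s := {f | Admissible (e.stepMatrix u M) F f}) (ih _) fun _ h => h.2
    exact Finite.of_equiv _ (admissibleConsEquiv M e F).symm

theorem card_admissible (M : ℕ → ℕ → ZMod 2) (F : List Event) :
    Nat.card {f // Admissible M F f} = count M F := by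
  induction F generalizing M with
  | nil =>
    have : Unique {f // Admissible M [] f} :=
      ⟨⟨⟨fun _ => 0, fun _ => rfl⟩⟩, fun f => Subtype.ext (funext fun n => f.2 n)⟩
    rw [Nat.card_unique, count]
  | cons e F ih =>
    have (u : ZMod 2) : Finite {f // e.Admits u M ∧ Admissible (e.stepMatrix u M) F f} :=
      Set.Finite.subset (s := {f | Admissible (e.stepMatrix u M) F f}) (finite_admissible _ F)
        fun _ h => h.2
    rw [Nat.card_congr (admissibleConsEquiv M e F), Nat.card_sigma, count]
    refine Finset.sum_congr rfl fun u _ => ?_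
    split_ifs with h
    · simp only [h, true_and, ih]
    · simp [h]

/-- The recursion in terms of the half-disks of the whole front, for a front `pre ++ suf` that has
already been swept over `pre`. -/
theorem admissible_iff (f : ℕ → ZMod 2) (pre suf : List Event) :
    Admissible (diskMatrix f pre.reverse) suf (fun n => f (pre.length + n)) ↔
      (∀ n, f (pre.length + suf.length + n) = 0) ∧
      ∀ (n : ℕ) (h : n < suf.length), suf[n].Admits (f (pre.length + n))
        (diskMatrix f (pre ++ suf.take n).reverse) := by
  induction suf generalizing pre with
  | nil => simp [Admissible]
  | cons e suf ih =>
    have h := ih (pre ++ [e])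
    rw [List.reverse_append, List.reverse_singleton, List.singleton_append, diskMatrix_cons,
      List.length_reverse] at h
    simp only [List.length_append, List.length_singleton, add_assoc, add_comm 1] at h
    rw [Admissible, add_zero]
    simp only [add_assoc] at h ⊢
    rw [h]
    simp only [List.length_cons, add_assoc, add_comm 1]
    constructor
    · rintro ⟨h0, h1, h2⟩
      refine ⟨h1, fun n hn => ?_⟩
      cases n with
      | zero => simpa using h0
      | succ n => simpa using h2 n (by omega)
    · rintro ⟨h1, h2⟩
      refine ⟨by simpa using h2 0 (by omega), h1, fun n hn => ?_⟩
      have := h2 (n + 1) (by omega)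
      rw [List.getElem_cons_succ] at this
      simpa using this

/-! ### Closed fronts whose crossings have degree zero -/

/-- The two strands of a crossing have the same Maslov potential, i.e. its chord has degree `0`. -/
def Event.IsFlat (e : Event) (s : List ℤ) : Prop :=
  match e with
  | .crossing k => s.getD (k + 1) 0 = s.getD k 0
  | _ => True

/-- If `s` are the Maslov potentials of the strands to the left of `F`, then `F` is well-formed,
no strand is left over on the right, and all crossings have degree `0`. -/
def IsFlatFrom : List ℤ → List Event → Prop
  | s, [] => s = []
  | s, e :: F => e.Allowed s ∧ e.IsFlat s ∧ IsFlatFrom (e.step s) F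

theorem IsFlatFrom.spec {s : List ℤ} {F : List Event} (h : IsFlatFrom s F) :
    (∀ (n : ℕ) (hn : n < F.length),
      F[n].Allowed ((F.take n).foldl (fun s e => e.step s) s) ∧
      F[n].IsFlat ((F.take n).foldl (fun s e => e.step s) s)) ∧
    F.foldl (fun s e => e.step s) s = [] := by
  induction F generalizing s with
  | nil => exact ⟨by simp, h⟩
  | cons e F ih =>
    obtain ⟨h1, h2, h3⟩ := h
    refine ⟨fun n hn => ?_, (ih h3).2⟩
    cases n with
    | zero => exact ⟨h1, h2⟩
    | succ n => exact (ih h3).1 n (by simpa using hn)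

theorem IsFlatFrom.isClosed {F : Front} (h : IsFlatFrom [] F) : F.IsClosed :=
  ⟨fun n => (h.spec.1 n.1 n.2).1, by simpa [Front.potentials] using h.spec.2⟩

theorem IsFlatFrom.degree_eq {F : Front} (h : IsFlatFrom [] F) (c : F.Chord) :
    F.degree c = match F.get c.1 with
      | .rightCusp _ => 1
      | _ => 0 := by
  have hc : (F.get c.1).IsFlat (F.potentials c.1) := (h.spec.1 c.1.1 c.1.2).2
  unfold Front.degree
  revert hc
  generalize F.get c.1 = e
  intro hc
  cases e with
  | leftCusp k m => rfl
  | crossing k => exact sub_eq_zero.mpr hc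
  | rightCusp k => rfl

/-- The values of the Reeb chords, indexed by the number of the event. -/
def Front.extend (F : Front) (v : F.Chord → ZMod 2) (n : ℕ) : ZMod 2 :=
  F.evalLetter v 1 (.chord n)

theorem Front.evalDisks_eq_wordSum (F : Front) (v : F.Chord → ZMod 2) (c : F.Chord) :
    F.evalDisks v 1 c = wordSum (F.extend v) (F.disks c) := by
  unfold Front.evalDisks wordSum
  congr 2

theorem Front.extend_chord (F : Front) (v : F.Chord → ZMod 2) (c : F.Chord) :
    F.extend v c.1 = v c := by
  have : ∃ h' : c.1.1 < F.length, (F.get ⟨c.1.1, h'⟩).IsChord = true := ⟨c.1.2, c.2⟩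
  simp only [Front.extend, Front.evalLetter, this, dif_pos]

/-- The augmentation equations hold for `v` iff its extension passes the recursion. -/
theorem admissible_extend_iff {F : Front} (h : IsFlatFrom [] F) (v : F.Chord → ZMod 2) :
    Admissible (fun _ _ => 0) F (F.extend v) ↔
      (∀ c, F.degree c ≠ 0 → v c = 0) ∧ ∀ c, F.evalDisks v 1 c = 0 := by
  have key := admissible_iff (F.extend v) [] F
  simp only [List.reverse_nil, diskMatrix_nil, List.length_nil, zero_add, List.nil_append] at key
  rw [key]
  have hzero : ∀ n, (¬ ∃ h' : n < F.length, (F.get ⟨n, h'⟩).IsChord = true) →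
      F.extend v n = 0 := by
    intro n hn
    simp only [Front.extend, Front.evalLetter, hn, dif_neg, not_false_eq_true]
  have hchord (c : F.Chord) : (F.get c.1).Admits (F.extend v c.1)
      (diskMatrix (F.extend v) (F.take c.1).reverse) ↔
        (F.degree c ≠ 0 → v c = 0) ∧ F.evalDisks v 1 c = 0 := by
    rw [h.degree_eq, F.evalDisks_eq_wordSum, F.extend_chord]
    have h2 := c.2
    unfold Front.disks
    revert h2
    cases F.get c.1 with
    | leftCusp k m => simp [Event.IsChord]
    | crossing k => simp [Event.Admits, diskMatrix]
    | rightCusp k =>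
      have h1 (x : ZMod 2) : x = 1 ↔ 1 + x = 0 := by revert x; decide
      have h2 (l : List (List Letter)) :
          wordSum (F.extend v) ([] :: l) = 1 + wordSum (F.extend v) l := by simp [wordSum]
      simp [Event.Admits, diskMatrix, h1, h2]
  constructor
  · rintro ⟨-, h2⟩
    have := fun c : F.Chord => (hchord c).mp (h2 c.1.1 c.1.2)
    exact ⟨fun c => (this c).1, fun c => (this c).2⟩
  · rintro ⟨h1, h2⟩
    refine ⟨fun n => hzero _ fun ⟨h, _⟩ => by omega, fun n hn => ?_⟩
    by_cases hc : (F.get ⟨n, hn⟩).IsChord = true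
    · exact (hchord ⟨⟨n, hn⟩, hc⟩).mpr ⟨h1 _, h2 _⟩
    · have h0 : F.extend v n = 0 := hzero n fun ⟨_, h⟩ => hc h
      rw [h0]
      change (F.get ⟨n, hn⟩).Admits _ _
      revert hc
      cases F.get ⟨n, hn⟩ <;> simp [Event.IsChord, Event.Admits]

/-- Admissible valuations are supported on the Reeb chords. -/
theorem Admissible.eq_zero {M : ℕ → ℕ → ZMod 2} {F : List Event} {f : ℕ → ZMod 2}
    (h : Admissible M F f) (n : ℕ) (hn : ¬ ∃ h' : n < F.length, F[n].IsChord = true) :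
    f n = 0 := by
  induction F generalizing M f n with
  | nil => exact h n
  | cons e F ih =>
    cases n with
    | zero =>
      have := h.1
      cases e <;> simp_all [Event.IsChord, Event.Admits]
    | succ n => exact ih h.2 n fun ⟨h1, h2⟩ => hn ⟨by simpa using h1, by simpa using h2⟩

/-- Extension by zero identifies the solutions of the augmentation equations with the admissible
valuations of the events. -/
def solutionEquiv {F : Front} (h : IsFlatFrom [] F) :
    {v : F.Chord → ZMod 2 // (∀ c, F.degree c ≠ 0 → v c = 0) ∧ ∀ c, F.evalDisks v 1 c = 0} ≃
      {f // Admissible (fun _ _ => 0) F f} :=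
  have extend_restrict (f : {f // Admissible (fun _ _ => 0) F f}) :
      F.extend (fun c => f.1 c.1) = f.1 := by
    funext n
    by_cases hn : ∃ h' : n < F.length, (F.get ⟨n, h'⟩).IsChord = true
    · exact F.extend_chord _ ⟨⟨n, hn.1⟩, hn.2⟩
    · rw [f.2.eq_zero n hn]
      simp only [Front.extend, Front.evalLetter, hn, dif_neg, not_false_eq_true]
  { toFun := fun v => ⟨F.extend v.1, (admissible_extend_iff h _).mpr v.2⟩
    invFun := fun f => ⟨fun c => f.1 c.1,
      (admissible_extend_iff h _).mp ((extend_restrict f).symm ▸ f.2)⟩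
    left_inv := fun v => Subtype.ext (funext fun c => F.extend_chord v.1 c)
    right_inv := fun f => Subtype.ext (extend_restrict f) }

theorem card_augmentation {F : Front} (h : IsFlatFrom [] F) :
    Nat.card (Augmentation F) = count (fun _ _ => 0) F := by
  rw [Nat.card_congr ((augmentationEquiv F).trans (solutionEquiv h)), card_admissible]

theorem IsFlatFrom.augEquiv_eq {F : Front} (h : IsFlatFrom [] F) : AugEquiv F = Eq := by
  funext ε₁ ε₂
  refine propext (augEquiv_iff_eq (fun c => ?_) ε₁ ε₂)
  rw [h.degree_eq]
  split <;> simp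

/-- Equivalence of augmentations is equality, so the number of classes is the count over the
events. -/
theorem card_quot_augEquiv {F : Front} (h : IsFlatFrom [] F) :
    Nat.card (Quot (AugEquiv F)) = count (fun _ _ => 0) F := by
  rw [← card_augmentation h, h.augEquiv_eq]
  exact (Nat.card_congr
    ⟨Quot.mk _, Quot.lift id fun _ _ h => h, fun _ => rfl, Quot.ind fun _ => rfl⟩).symm


/-! ### Counting on direct sums of pairs of strands -/

/-- The half-disk matrix of `2 * N` strands for which the only half-disks, counted modulo `2`, are
those between the strands `2 * i` and `2 * i + 1`. -/
def pairing (N : ℕ) : ℕ → ℕ → ZMod 2 := fun i j =>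
  if i % 2 = 0 ∧ j = i + 1 ∧ j < 2 * N then 1 else 0

theorem pairing_zero : pairing 0 = fun _ _ => 0 := by
  funext i j
  simp [pairing]

theorem count_leftCusp (M : ℕ → ℕ → ZMod 2) (k : ℕ) (m : ℤ) (F : List Event) :
    count M (.leftCusp k m :: F) = count ((Event.leftCusp k m).stepMatrix 0 M) F := by
  rw [count]
  exact (Fintype.sum_eq_single 0 fun u hu => if_neg hu).trans (if_pos rfl)

theorem count_crossing (M : ℕ → ℕ → ZMod 2) (k : ℕ) (F : List Event) (h : M k (k + 1) = 0) :
    count M (.crossing k :: F) = count ((Event.crossing k).stepMatrix 0 M) F +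
      count ((Event.crossing k).stepMatrix 1 M) F := by
  simp only [count, Event.Admits, h, if_true]
  exact Fin.sum_univ_two _

theorem count_crossing_of_ne (M : ℕ → ℕ → ZMod 2) (k : ℕ) (F : List Event) (h : M k (k + 1) ≠ 0) :
    count M (.crossing k :: F) = 0 := by
  simp [count, Event.Admits, h]

theorem count_rightCusp (M : ℕ → ℕ → ZMod 2) (k : ℕ) (F : List Event) (h : M k (k + 1) = 1) :
    count M (.rightCusp k :: F) = count ((Event.rightCusp k).stepMatrix 0 M) F := by
  simp [count, Event.Admits, h]

theorem count_rightCusp_of_ne (M : ℕ → ℕ → ZMod 2) (k : ℕ) (F : List Event) (h : M k (k + 1) ≠ 1) :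
    count M (.rightCusp k :: F) = 0 := by
  simp [count, Event.Admits, h]

theorem count_cons_congr {M : ℕ → ℕ → ZMod 2} {e : Event} {F F' : List Event}
    (h : ∀ M, count M F = count M F') : count M (e :: F) = count M (e :: F') := by
  simp [count, h]

/-- The matrix after a crossing with value `u` between two neighbouring pairs. -/
theorem stepMatrix_crossing_pairing {N t : ℕ} (ht : t + 1 < N) (u : ZMod 2) :
    (Event.crossing (2 * t + 1)).stepMatrix u (pairing N) = fun i j =>
      if i = 2 * t then (if j = 2 * t + 1 then u else if j = 2 * t + 2 then 1 else 0)
      else if i = 2 * t + 1 then (if j = 2 * t + 3 then 1 else 0)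
      else if i = 2 * t + 2 then (if j = 2 * t + 3 then u else 0)
      else pairing N i j := by
  funext i j
  simp only [Event.stepMatrix, pairing]
  grind (splits := 30)

/-- The matrix after crossings with values `u`, `v` between three neighbouring pairs. -/
theorem stepMatrix_two_crossings_pairing {N t : ℕ} (ht : t + 2 < N) (u v : ZMod 2) :
    (Event.crossing (2 * t + 3)).stepMatrix v
      ((Event.crossing (2 * t + 1)).stepMatrix u (pairing N)) = fun i j =>
      if i = 2 * t then (if j = 2 * t + 1 then u else if j = 2 * t + 2 then 1 else 0)
      else if i = 2 * t + 1 then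
        (if j = 2 * t + 3 then v else if j = 2 * t + 4 then 1 else 0)
      else if i = 2 * t + 2 then
        (if j = 2 * t + 3 then u * v else if j = 2 * t + 4 then u else 0)
      else if i = 2 * t + 3 then (if j = 2 * t + 5 then 1 else 0)
      else if i = 2 * t + 4 then (if j = 2 * t + 5 then v else 0)
      else pairing N i j := by
  rw [stepMatrix_crossing_pairing (by omega)]
  funext i j
  simp only [Event.stepMatrix, pairing]
  grind (splits := 30)

theorem count_pairing_leftCusp {N t : ℕ} (ht : t ≤ N) (m : ℤ) (F : List Event) :
    count (pairing N) (.leftCusp (2 * t) m :: F) = count (pairing (N + 1)) F := by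
  rw [count_leftCusp]
  congr 1
  funext i j
  simp only [Event.stepMatrix, pairing]
  grind (splits := 30)

theorem count_pairing_rightCusp {N t : ℕ} (ht : t ≤ N) (F : List Event) :
    count (pairing (N + 1)) (.rightCusp (2 * t) :: F) = count (pairing N) F := by
  rw [count_rightCusp _ _ _ (by simp [pairing]; omega)]
  congr 1
  funext i j
  simp only [Event.stepMatrix, pairing]
  grind (splits := 30)

/-- The right edge of a tile that shares only its upper right vertex. -/
theorem count_pairing_bottom {N t : ℕ} (ht : t < N) (F : List Event) :
    count (pairing (N + 1)) (.crossing (2 * t + 1) :: .rightCusp (2 * t) :: F) =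
      count (pairing N) F := by
  have h (u : ZMod 2) := stepMatrix_crossing_pairing (N := N + 1) (t := t) (by omega) u
  rw [count_crossing _ _ _ (by simp [pairing]), h, h,
    count_rightCusp_of_ne _ _ _ (by simp), count_rightCusp _ _ _ (by simp), zero_add]
  congr 1
  funext i j
  simp only [Event.stepMatrix, pairing]
  grind (splits := 30)

/-- The right edge of a tile that shares only its lower right vertex. -/
theorem count_pairing_top {N t : ℕ} (ht : t < N) (F : List Event) :
    count (pairing (N + 1)) (.crossing (2 * t + 1) :: .rightCusp (2 * t + 2) :: F) =
      count (pairing N) F := by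
  have h (u : ZMod 2) := stepMatrix_crossing_pairing (N := N + 1) (t := t) (by omega) u
  rw [count_crossing _ _ _ (by simp [pairing]), h, h,
    count_rightCusp_of_ne _ _ _ (by simp), count_rightCusp _ _ _ (by simp), zero_add]
  congr 1
  funext i j
  simp only [Event.stepMatrix, pairing]
  grind (splits := 30)

/-- The right edge of a tile that shares both of its right vertices: both crossings need to have
the value `1`. -/
theorem count_pairing_middle {N t : ℕ} (ht : t + 1 < N) (F : List Event) :
    count (pairing (N + 1)) (.crossing (2 * t + 1) :: .crossing (2 * t + 3) ::
      .rightCusp (2 * t + 2) :: F) = count (pairing N) F := by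
  have h (u v : ZMod 2) :=
    stepMatrix_two_crossings_pairing (N := N + 1) (t := t) (by omega) u v
  have h' (u : ZMod 2) : (Event.crossing (2 * t + 1)).stepMatrix u (pairing (N + 1))
      (2 * t + 3) (2 * t + 3 + 1) = 0 := by
    rw [stepMatrix_crossing_pairing (by omega)]
    simp [pairing]
  -- The half-disks at the right cusp sum up to `u * v`, so three of the four summands vanish.
  rw [count_crossing _ _ _ (by simp [pairing]), count_crossing _ _ _ (h' 0),
    count_crossing _ _ _ (h' 1), h, h, h, h, count_rightCusp_of_ne _ _ _ (by simp),
    count_rightCusp_of_ne _ _ _ (by simp), count_rightCusp_of_ne _ _ _ (by simp),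
    count_rightCusp _ _ _ (by simp)]
  simp only [zero_add]
  congr 1
  funext i j
  simp only [Event.stepMatrix, pairing]
  grind (splits := 30)

/-- A clasp has three admissible pairs of values `u`, `v` at its crossings, the solutions of
`1 + u * v = 1`. -/
theorem count_pairing_clasp {N t : ℕ} (ht : t < N) (r : ℤ) (F : List Event) :
    count (pairing N) (clasp (2 * t) r ++ F) = 3 * count (pairing N) F := by
  simp only [clasp, List.cons_append, List.nil_append]
  have h0 : (Event.leftCusp (2 * t + 1) (r - 1)).stepMatrix 0 (pairing N) = fun i j =>
      if i = 2 * t then (if j = 2 * t + 3 then 1 else 0)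
      else if i = 2 * t + 1 then (if j = 2 * t + 2 then 1 else 0)
      else pairing (N + 1) i j - if i = 2 * t + 2 ∧ j = 2 * t + 3 then 1 else 0 := by
    funext i j
    simp only [Event.stepMatrix, pairing]
    grind (splits := 30)
  have h1 (u : ZMod 2) : (Event.crossing (2 * t)).stepMatrix u
      ((Event.leftCusp (2 * t + 1) (r - 1)).stepMatrix 0 (pairing N)) = fun i j =>
      if i = 2 * t then (if j = 2 * t + 2 then 1 else 0)
      else if i = 2 * t + 1 then (if j = 2 * t + 3 then 1 else if j = 2 * t + 2 then u else 0)
      else pairing (N + 1) i j - if i = 2 * t + 2 ∧ j = 2 * t + 3 then 1 else 0 := by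
    rw [h0]
    funext i j
    simp only [Event.stepMatrix, pairing]
    grind (splits := 30)
  have h2 (u v : ZMod 2) : (Event.crossing (2 * t + 2)).stepMatrix v
      ((Event.crossing (2 * t)).stepMatrix u
      ((Event.leftCusp (2 * t + 1) (r - 1)).stepMatrix 0 (pairing N))) = fun i j =>
      if i = 2 * t then (if j = 2 * t + 2 then v else if j = 2 * t + 3 then 1 else 0)
      else if i = 2 * t + 1 then
        (if j = 2 * t + 2 then 1 + u * v else if j = 2 * t + 3 then u else 0)
      else pairing (N + 1) i j - if i = 2 * t + 2 ∧ j = 2 * t + 3 then 1 else 0 := by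
    rw [h1]
    funext i j
    simp only [Event.stepMatrix, pairing]
    grind (splits := 30)
  have h3 (u v : ZMod 2) (huv : u * v = 0) : (Event.rightCusp (2 * t + 1)).stepMatrix 0
      ((Event.crossing (2 * t + 2)).stepMatrix v ((Event.crossing (2 * t)).stepMatrix u
      ((Event.leftCusp (2 * t + 1) (r - 1)).stepMatrix 0 (pairing N)))) = pairing N := by
    rw [h2]
    funext i j
    simp only [Event.stepMatrix, pairing]
    grind (splits := 30)
  have h4 (u v : ZMod 2) (huv : u * v = 0) : (Event.crossing (2 * t + 2)).stepMatrix v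
      ((Event.crossing (2 * t)).stepMatrix u
      ((Event.leftCusp (2 * t + 1) (r - 1)).stepMatrix 0 (pairing N)))
      (2 * t + 1) (2 * t + 1 + 1) = 1 := by
    rw [h2]
    simp [huv]
  have h5 : (Event.crossing (2 * t + 2)).stepMatrix 1
      ((Event.crossing (2 * t)).stepMatrix 1
      ((Event.leftCusp (2 * t + 1) (r - 1)).stepMatrix 0 (pairing N)))
      (2 * t + 1) (2 * t + 1 + 1) ≠ 1 := by
    rw [h2]
    simp
  have h6 (u : ZMod 2) : (Event.crossing (2 * t)).stepMatrix u
      ((Event.leftCusp (2 * t + 1) (r - 1)).stepMatrix 0 (pairing N))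
      (2 * t + 2) (2 * t + 2 + 1) = 0 := by
    rw [h1]
    simp [pairing, show 2 * t + 2 + 1 < 2 * (N + 1) by omega]
  rw [count_leftCusp, count_crossing _ _ _ (by rw [h0]; simp), count_crossing _ _ _ (h6 0),
    count_crossing _ _ _ (h6 1), count_rightCusp _ _ _ (h4 0 0 rfl),
    count_rightCusp _ _ _ (h4 0 1 rfl), count_rightCusp _ _ _ (h4 1 0 rfl),
    count_rightCusp_of_ne _ _ _ h5, h3 0 0 rfl, h3 0 1 rfl, h3 1 0 rfl]
  ring

/-! ### Rows of crossings -/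

/-- Consecutive crossings, from bottom to top, between `m + 1` consecutive pairs of strands, the
first of which is pair number `t`. -/
def crossings : ℕ → ℕ → List Event
  | _, 0 => []
  | t, m + 1 => .crossing (2 * t + 1) :: crossings (t + 1) m

theorem crossings_add (t m m' : ℕ) :
    crossings t (m + m') = crossings t m ++ crossings (t + m) m' := by
  induction m generalizing t with
  | zero => simp [crossings]
  | succ m ih =>
    rw [Nat.succ_add, crossings, ih, crossings, List.cons_append, Nat.succ_add_eq_add_succ]

/-- A right cusp commutes with a crossing of higher strands, whose number drops by two. -/
theorem stepMatrix_rightCusp_crossing (M : ℕ → ℕ → ZMod 2) (u : ZMod 2) {k l : ℕ} (h : l ≤ k) :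
    (Event.rightCusp l).stepMatrix 0 ((Event.crossing (k + 2)).stepMatrix u M) =
      (Event.crossing k).stepMatrix u ((Event.rightCusp l).stepMatrix 0 M) := by
  funext i j
  simp only [Event.stepMatrix]
  grind (splits := 30)

/-- A right cusp can be moved to the left of a row of crossings of higher strands. -/
theorem count_crossings_rightCusp (M : ℕ → ℕ → ZMod 2) {l t : ℕ} (h : l ≤ 2 * t + 1) (m : ℕ)
    (F : List Event) :
    count M (crossings (t + 1) m ++ .rightCusp l :: F) =
      count M (.rightCusp l :: (crossings t m ++ F)) := by
  induction m generalizing M t with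
  | zero => simp [crossings]
  | succ m ih =>
    have hk : M (2 * (t + 1) + 1) (2 * (t + 1) + 1 + 1) =
        (Event.rightCusp l).stepMatrix 0 M (2 * t + 1) (2 * t + 1 + 1) := by
      simp only [Event.stepMatrix]
      split_ifs <;> first | omega | rfl
    have hl (u : ZMod 2) : (Event.crossing (2 * (t + 1) + 1)).stepMatrix u M l (l + 1) =
        if l < l + 1 then M l (l + 1) else 0 := by
      simp only [Event.stepMatrix]
      split_ifs <;> first | omega | rfl
    simp only [crossings, List.cons_append, lt_add_one, if_true] at hl ⊢
    rw [count_cons_congr fun M => ih M (t := t + 1) (by omega)]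
    by_cases h1 : M l (l + 1) = 1
    · rw [count_rightCusp _ _ _ h1]
      by_cases h0 : M (2 * (t + 1) + 1) (2 * (t + 1) + 1 + 1) = 0
      · rw [count_crossing _ _ _ h0, count_crossing _ _ _ (hk ▸ h0),
          count_rightCusp _ _ _ ((hl 0).trans h1), count_rightCusp _ _ _ ((hl 1).trans h1)]
        rw [show 2 * (t + 1) + 1 = 2 * t + 1 + 2 by ring, stepMatrix_rightCusp_crossing _ _ h,
          stepMatrix_rightCusp_crossing _ _ h]
      · rw [count_crossing_of_ne _ _ _ h0, count_crossing_of_ne _ _ _ (hk ▸ h0)]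
    · rw [count_rightCusp_of_ne _ _ _ h1]
      by_cases h0 : M (2 * (t + 1) + 1) (2 * (t + 1) + 1 + 1) = 0
      · rw [count_crossing _ _ _ h0, count_rightCusp_of_ne _ _ _ ((hl 0).trans_ne h1),
          count_rightCusp_of_ne _ _ _ ((hl 1).trans_ne h1)]
      · rw [count_crossing_of_ne _ _ _ h0]

/-- The right edge of a lowest tile that shares none of its right vertices. -/
theorem count_crossings_free {N : ℕ} (t m : ℕ) (F : List Event) :
    count (pairing (N + 1)) (crossings (t + 1) m ++ .rightCusp 0 :: F) =
      count (pairing N) (crossings t m ++ F) := by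
  rw [count_crossings_rightCusp _ (by omega), ← mul_zero 2, count_pairing_rightCusp (by omega)]

/-- The lowest tile can be closed right after the first crossing. -/
theorem count_crossings_bottom {N t : ℕ} (ht : t < N) (m : ℕ) (F : List Event) :
    count (pairing (N + 1)) (crossings t (m + 1) ++ .rightCusp (2 * t) :: F) =
      count (pairing N) (crossings t m ++ F) := by
  rw [crossings, List.cons_append,
    count_cons_congr fun M => count_crossings_rightCusp M (by omega) m F,
    count_pairing_bottom ht]

/-- A tile between two new tiles can be closed right after its two crossings. -/
theorem count_crossings_middle {N t : ℕ} (ht : t + 1 < N) (m : ℕ) (F : List Event) :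
    count (pairing (N + 1)) (crossings t (m + 2) ++ .rightCusp (2 * (t + 1)) :: F) =
      count (pairing N) (crossings (t + 1) m ++ F) := by
  rw [crossings, crossings, List.cons_append, List.cons_append,
    count_cons_congr fun M => count_cons_congr fun M =>
      count_crossings_rightCusp M (by omega) m F]
  exact count_pairing_middle ht _


/-! ### Potentials of pairs of strands -/

/-- The potentials of the strands on the bottom and top edges of tiles whose bottom edges have the
potentials `l`. -/
def pairPotentials (l : List ℤ) : List ℤ := l.flatMap fun h => [h, h + 1]

theorem pairPotentials_append (x y : List ℤ) :
    pairPotentials (x ++ y) = pairPotentials x ++ pairPotentials y :=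
  List.flatMap_append

theorem pairPotentials_cons (h : ℤ) (x : List ℤ) :
    pairPotentials (h :: x) = h :: (h + 1) :: pairPotentials x := rfl

theorem length_pairPotentials (x : List ℤ) : (pairPotentials x).length = 2 * x.length := by
  induction x with
  | nil => rfl
  | cons h x ih => simp [pairPotentials_cons, ih]; ring

theorem IsFlatFrom.leftCusp {a b : List ℤ} {k : ℕ} (hk : a.length = k) {m : ℤ} {F : List Event}
    (hF : IsFlatFrom (a ++ m :: (m + 1) :: b) F) :
    IsFlatFrom (a ++ b) (.leftCusp k m :: F) := by
  subst hk
  exact ⟨by simp [Event.Allowed], trivial, by simpa [Event.step] using hF⟩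

theorem IsFlatFrom.rightCusp {a b : List ℤ} {k : ℕ} (hk : a.length = k) {m : ℤ} {F : List Event}
    (hF : IsFlatFrom (a ++ b) F) :
    IsFlatFrom (a ++ m :: (m + 1) :: b) (.rightCusp k :: F) := by
  subst hk
  exact ⟨by simp [Event.Allowed], trivial, by simpa [Event.step] using hF⟩

theorem IsFlatFrom.crossing {a b : List ℤ} {k : ℕ} (hk : a.length = k) {m : ℤ} {F : List Event}
    (hF : IsFlatFrom (a ++ m :: m :: b) F) :
    IsFlatFrom (a ++ m :: m :: b) (.crossing k :: F) := by
  subst hk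
  exact ⟨by simp [Event.Allowed], by simp [Event.IsFlat], by simpa [Event.step] using hF⟩

theorem isFlatFrom_leftCusp {x y : List ℤ} {t : ℕ} (ht : x.length = t) {h : ℤ} {F : List Event}
    (hF : IsFlatFrom (pairPotentials (x ++ h :: y)) F) :
    IsFlatFrom (pairPotentials (x ++ y)) (.leftCusp (2 * t) h :: F) := by
  rw [pairPotentials_append] at hF ⊢
  exact hF.leftCusp (by rw [length_pairPotentials, ht])

theorem isFlatFrom_rightCusp {x y : List ℤ} {t : ℕ} (ht : x.length = t) {h : ℤ} {F : List Event}
    (hF : IsFlatFrom (pairPotentials (x ++ y)) F) :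
    IsFlatFrom (pairPotentials (x ++ h :: y)) (.rightCusp (2 * t) :: F) := by
  rw [pairPotentials_append] at hF ⊢
  exact hF.rightCusp (by rw [length_pairPotentials, ht])

theorem isFlatFrom_crossing {x y : List ℤ} {t : ℕ} (ht : x.length = t) {h : ℤ} {F : List Event}
    (hF : IsFlatFrom (pairPotentials (x ++ h :: (h + 1) :: y)) F) :
    IsFlatFrom (pairPotentials (x ++ h :: (h + 1) :: y)) (.crossing (2 * t + 1) :: F) := by
  have e : pairPotentials (x ++ h :: (h + 1) :: y) =
      (pairPotentials x ++ [h]) ++ (h + 1) :: (h + 1) :: (h + 1 + 1) :: pairPotentials y := by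
    simp [pairPotentials_append, pairPotentials_cons]
  rw [e] at hF ⊢
  exact hF.crossing (by simp [length_pairPotentials, ht])

theorem isFlatFrom_clasp {x y : List ℤ} {t : ℕ} (ht : x.length = t) {h : ℤ} {F : List Event}
    (hF : IsFlatFrom (pairPotentials (x ++ h :: y)) F) :
    IsFlatFrom (pairPotentials (x ++ h :: y)) (clasp (2 * t) (h + 1) ++ F) := by
  have hl : (pairPotentials x).length = 2 * t := by rw [length_pairPotentials, ht]
  rw [pairPotentials_append, pairPotentials_cons] at hF ⊢
  generalize pairPotentials x = a at *
  generalize pairPotentials y = b at *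
  have e : a ++ h :: (h + 1) :: b = (a ++ [h]) ++ (h + 1) :: b := by simp
  have h4 : IsFlatFrom ((a ++ [h]) ++ h :: (h + 1) :: ((h + 1) :: b))
      (.rightCusp (2 * t + 1) :: F) := by
    rw [e] at hF
    exact hF.rightCusp (by simp [hl])
  have e3 : (a ++ [h]) ++ h :: (h + 1) :: ((h + 1) :: b) =
      (a ++ [h, h]) ++ (h + 1) :: (h + 1) :: b := by simp
  have e2 : (a ++ [h, h]) ++ (h + 1) :: (h + 1) :: b =
      a ++ h :: h :: ((h + 1) :: (h + 1) :: b) := by simp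
  have h3 := IsFlatFrom.crossing (k := 2 * t + 2) (by simp [hl]) (e3 ▸ h4)
  have h2 := IsFlatFrom.crossing (k := 2 * t) hl (e2 ▸ h3)
  rw [← e2, ← e3] at h2
  have h1 := IsFlatFrom.leftCusp (k := 2 * t + 1) (by simp [hl]) h2
  rw [e]
  simpa [clasp] using h1

/-! ### Sweeping over parts of a front -/

/-- `F` leads from a grid column whose tiles have bottom edges at the heights `l` to one whose tiles
have bottom edges at the heights `l'`. In both, exactly the pairs of strands that bound a tile are
joined by half-disks, and there are `c` ways to choose the values of the events of `F`. This is
expressed by comparing all continuations `G` of the front to the right of `F`. -/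
def Leads (l : List ℤ) (F : List Event) (l' : List ℤ) (c : ℕ) : Prop :=
  ∀ G, (IsFlatFrom (pairPotentials l') G → IsFlatFrom (pairPotentials l) (F ++ G)) ∧
    count (pairing l.length) (F ++ G) = c * count (pairing l'.length) G

theorem Leads.refl (l : List ℤ) : Leads l [] l 1 := fun G => ⟨id, by simp⟩

theorem Leads.trans {l l' l'' : List ℤ} {F F' : List Event} {c c' : ℕ} (h : Leads l F l' c)
    (h' : Leads l' F' l'' c') : Leads l (F ++ F') l'' (c * c') := fun G => by
  rw [List.append_assoc]
  exact ⟨fun hG => (h _).1 ((h' _).1 hG), by rw [(h _).2, (h' _).2, mul_assoc]⟩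

theorem leads_leftCusp {x y : List ℤ} {t : ℕ} (ht : x.length = t) (h : ℤ) :
    Leads (x ++ y) [.leftCusp (2 * t) h] (x ++ h :: y) 1 := fun G => by
  refine ⟨isFlatFrom_leftCusp ht, ?_⟩
  rw [List.singleton_append, count_pairing_leftCusp (by simp; omega), one_mul]
  congr 2
  simp
  ring

theorem leads_rightCusp {x y : List ℤ} {t : ℕ} (ht : x.length = t) (h : ℤ) :
    Leads (x ++ h :: y) [.rightCusp (2 * t)] (x ++ y) 1 := fun G => by
  refine ⟨isFlatFrom_rightCusp ht, ?_⟩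
  have : (x ++ h :: y).length = (x ++ y).length + 1 := by simp; ring
  rw [List.singleton_append, this, count_pairing_rightCusp (by simp; omega), one_mul]

theorem leads_clasp {x y : List ℤ} {t : ℕ} (ht : x.length = t) (h : ℤ) :
    Leads (x ++ h :: y) (clasp (2 * t) (h + 1)) (x ++ h :: y) 3 := fun G =>
  ⟨isFlatFrom_clasp ht, count_pairing_clasp (by simp; omega) _ _⟩

/-- The arithmetic progression `a, a + d, …` with `n` members. -/
def progression (d : ℤ) : ℤ → ℕ → List ℤ
  | _, 0 => []
  | a, n + 1 => a :: progression d (a + d) n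

@[simp]
theorem length_progression (d a : ℤ) (n : ℕ) : (progression d a n).length = n := by
  induction n generalizing a with
  | zero => rfl
  | succ n ih => simp [progression, ih]

theorem progression_add (d a : ℤ) (m n : ℕ) :
    progression d a (m + n) = progression d a m ++ progression d (a + d * m) n := by
  induction m generalizing a with
  | zero => simp [progression]
  | succ m ih =>
    rw [Nat.succ_add, progression, ih, progression, List.cons_append]
    congr 3
    push_cast
    ring

/-- `n` left cusps that create every `s`-th pair of strands from pair number `t` on, with heights
`h, h + 2, …` of the lower strands. -/
def leftCusps (s : ℕ) : ℕ → ℤ → ℕ → List Event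
  | _, _, 0 => []
  | t, h, n + 1 => .leftCusp (2 * t) h :: leftCusps s (t + s) (h + 2) n

/-- `n` right cusps that end the pairs number `t, t + s, …`, where the number is the one after
the preceding right cusps. -/
def rightCusps (s : ℕ) : ℕ → ℕ → List Event
  | _, 0 => []
  | t, n + 1 => .rightCusp (2 * t) :: rightCusps s (t + s) n

/-- Left cusps of a column next to the empty plane. -/
theorem leads_leftCusps_one {x : List ℤ} {t : ℕ} (ht : x.length = t) (h : ℤ) (n : ℕ) :
    Leads x (leftCusps 1 t h n) (x ++ progression 2 h n) 1 := by
  induction n generalizing x t h with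
  | zero => simpa [progression, leftCusps] using Leads.refl x
  | succ n ih =>
    have h1 := leads_leftCusp (y := []) ht h
    have h2 := ih (x := x ++ [h]) (t := t + 1) (by simp [ht]) (h + 2)
    simpa [progression, leftCusps] using h1.trans h2

/-- Left cusps of tiles, each of which is above a tile of the column on the left. -/
theorem leads_leftCusps_two {x : List ℤ} {t : ℕ} (ht : x.length = t) (z : List ℤ) (h : ℤ)
    (n : ℕ) : Leads (x ++ progression 2 h n ++ z) (leftCusps 2 (t + 1) (h + 1) n)
      (x ++ progression 1 h (2 * n) ++ z) 1 := by
  induction n generalizing x t h with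
  | zero => simpa [progression, leftCusps] using Leads.refl (x ++ z)
  | succ n ih =>
    have h1 := leads_leftCusp (x := x ++ [h]) (y := progression 2 (h + 2) n ++ z) (t := t + 1)
      (by simp [ht]) (h + 1)
    have h2 := ih (x := x ++ [h, h + 1]) (t := t + 2) (by simp [ht]) (h + 2)
    have e1 : h + 2 + 1 = h + 1 + 2 := by ring
    have e2 : t + 2 + 1 = t + 1 + 2 := by ring
    have e3 : h + 1 + 1 = h + 2 := by ring
    rw [e1, e2] at h2
    simp only [List.append_assoc, List.cons_append, List.nil_append] at h1 h2
    simpa [progression, leftCusps, Nat.mul_succ, e3] using h1.trans h2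

theorem isFlatFrom_crossings {x : List ℤ} {t : ℕ} (ht : x.length = t) {z : List ℤ} {h : ℤ}
    {m : ℕ} {F : List Event}
    (hF : IsFlatFrom (pairPotentials (x ++ progression 1 h (m + 1) ++ z)) F) :
    IsFlatFrom (pairPotentials (x ++ progression 1 h (m + 1) ++ z)) (crossings t m ++ F) := by
  induction m generalizing x t h with
  | zero => exact hF
  | succ m ih =>
    have e : x ++ progression 1 h (m + 2) ++ z =
        x ++ h :: (h + 1) :: (progression 1 (h + 1 + 1) m ++ z) := by simp [progression]
    have e' : x ++ progression 1 h (m + 2) ++ z =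
        (x ++ [h]) ++ progression 1 (h + 1) (m + 1) ++ z := by simp [progression]
    have h1 : IsFlatFrom (pairPotentials (x ++ progression 1 h (m + 2) ++ z))
        (crossings (t + 1) m ++ F) := by
      rw [e'] at hF ⊢
      exact ih (by simp [ht]) hF
    rw [e] at h1 ⊢
    exact isFlatFrom_crossing ht h1

/-- Right cusps of every second tile. -/
theorem isFlatFrom_rightCusps_one {x : List ℤ} {t : ℕ} (ht : x.length = t) {z : List ℤ} {h : ℤ}
    {n : ℕ} {F : List Event}
    (hF : IsFlatFrom (pairPotentials (x ++ progression 2 (h + 1) n ++ z)) F) :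
    IsFlatFrom (pairPotentials (x ++ progression 1 h (2 * n) ++ z)) (rightCusps 1 t n ++ F) := by
  induction n generalizing x t h with
  | zero => exact hF
  | succ n ih =>
    have e3 : h + 1 + 1 = h + 2 := by ring
    have e1 : h + 1 + 2 = h + 2 + 1 := by ring
    simp only [Nat.mul_succ, progression, rightCusps, List.append_assoc, List.cons_append, e3,
      e1] at hF ⊢
    refine isFlatFrom_rightCusp ht ?_
    have := ih (x := x ++ [h + 1]) (t := t + 1) (by simp [ht]) (h := h + 2)
      (by simpa using hF)
    simpa using this

/-- Right cusps of tiles that do not meet the column on the right. -/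
theorem isFlatFrom_rightCusps_zero {x z : List ℤ} {F : List Event}
    (hF : IsFlatFrom (pairPotentials z) F) :
    IsFlatFrom (pairPotentials (x ++ z)) (rightCusps 0 0 x.length ++ F) := by
  induction x with
  | nil => exact hF
  | cons h x ih => exact isFlatFrom_rightCusp (x := []) rfl ih

theorem count_rightCusps_one {N t : ℕ} (n r : ℕ) (ht : t + n + r < N) (F : List Event) :
    count (pairing (N + n)) (crossings t (2 * n + r) ++ (rightCusps 1 (t + 1) n ++ F)) =
      count (pairing N) (crossings (t + n) r ++ F) := by
  induction n generalizing t with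
  | zero => simp [rightCusps]
  | succ n ih =>
    rw [show 2 * (n + 1) + r = 2 * n + r + 2 by ring, rightCusps, List.cons_append, ← add_assoc N,
      count_crossings_middle (by omega), ih (by omega), Nat.succ_add_eq_add_succ]

theorem count_rightCusps_zero {N : ℕ} (n m : ℕ) (F : List Event) :
    count (pairing (N + n)) (crossings n m ++ (rightCusps 0 0 n ++ F)) =
      count (pairing N) (crossings 0 m ++ F) := by
  induction n with
  | zero => simp [rightCusps]
  | succ n ih =>
    rw [rightCusps, List.cons_append, ← add_assoc N, mul_zero, count_crossings_free, ih]


theorem rightCusps_add (s t m n : ℕ) :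
    rightCusps s t (m + n) = rightCusps s t m ++ rightCusps s (t + s * m) n := by
  induction m generalizing t with
  | zero => simp [rightCusps]
  | succ m ih =>
    rw [Nat.succ_add, rightCusps, ih, rightCusps, List.cons_append]
    congr 3
    ring

/-! ### Grid lines -/

theorem mem_progression {d a r : ℤ} {n : ℕ} :
    r ∈ progression d a n ↔ ∃ i < n, r = a + d * (i : ℤ) := by
  induction n generalizing a with
  | zero => simp [progression]
  | succ n ih =>
    rw [progression, List.mem_cons, ih]
    constructor
    · rintro (rfl | ⟨i, hi, rfl⟩)
      · exact ⟨0, by simp⟩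
      · exact ⟨i + 1, by omega, by push_cast; ring⟩
    · rintro ⟨i, hi, rfl⟩
      cases i with
      | zero => simp
      | succ i => exact Or.inr ⟨i, by omega, by push_cast; ring⟩

theorem tilesBelow_progression {a r : ℤ} {i : ℕ} (n : ℕ)
    (hr : r = a + 2 * (i : ℤ) ∨ r = a + 2 * (i : ℤ) - 1) :
    tilesBelow (progression 2 a n) r = min i n := by
  unfold tilesBelow
  induction n with
  | zero => simp [progression]
  | succ n ih =>
    rw [progression_add, List.countP_append, ih]
    simp only [progression, List.countP_singleton, decide_eq_true_eq]
    split_ifs <;> omega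

theorem map_leftCusp_progression (f : ℤ → ℕ) (s t : ℕ) (b : ℤ) (n : ℕ)
    (hf : ∀ i < n, f (b + 2 * (i : ℤ)) = t + s * i) :
    (progression 2 b n).map (fun r => Event.leftCusp (2 * f r) (r - 1)) =
      leftCusps s t (b - 1) n := by
  induction n generalizing b t with
  | zero => rfl
  | succ n ih =>
    have h0 := hf 0 (by omega)
    rw [progression, List.map_cons, leftCusps, ih (t + s), show b + 2 - 1 = b - 1 + 2 by ring]
    · simp at h0
      rw [h0]
    · intro i hi
      have := hf (i + 1) (by omega)
      push_cast at this
      rw [show b + 2 + 2 * (i : ℤ) = b + 2 * ((i : ℤ) + 1) by ring, this]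
      ring

theorem map_rightCusp_progression (f : ℤ → ℕ) (s t : ℕ) (b : ℤ) (n : ℕ)
    (hf : ∀ i < n, f (b + 2 * (i : ℤ)) = t + s * i) :
    (progression 2 b n).map (fun r => Event.rightCusp (2 * f r)) = rightCusps s t n := by
  induction n generalizing b t with
  | zero => rfl
  | succ n ih =>
    have h0 := hf 0 (by omega)
    rw [progression, List.map_cons, rightCusps, ih (t + s)]
    · simp at h0
      rw [h0]
    · intro i hi
      have := hf (i + 1) (by omega)
      push_cast at this
      rw [show b + 2 + 2 * (i : ℤ) = b + 2 * ((i : ℤ) + 1) by ring, this]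
      ring

/-- The crossings at the vertices of tiles that share both of their left vertices. -/
theorem flatMap_crossing_progression (f : ℤ → ℕ) (old : List ℤ) (t : ℕ) (b : ℤ) (n : ℕ)
    (hf : ∀ i < n, f (b + 2 * (i : ℤ)) = t + 1 + 2 * i)
    (hold : ∀ i < n, b + 2 * (i : ℤ) - 1 ∈ old ∧ b + 2 * (i : ℤ) + 1 ∈ old) :
    ((progression 2 b n).flatMap fun r =>
      (if r - 1 ∈ old then [Event.crossing (2 * f r - 1)] else []) ++
      (if r + 1 ∈ old then [Event.crossing (2 * f r + 1)] else [])) = crossings t (2 * n) := by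
  induction n generalizing b t with
  | zero => rfl
  | succ n ih =>
    have h0 := hf 0 (by omega)
    have h1 := hold 0 (by omega)
    simp at h0 h1
    rw [progression, List.flatMap_cons, ih (t + 2)]
    · rw [if_pos h1.1, if_pos h1.2, h0, show 2 * (n + 1) = 2 + 2 * n by ring, crossings_add]
      simp [crossings]
      omega
    · intro i hi
      have := hf (i + 1) (by omega)
      push_cast at this
      rw [show b + 2 + 2 * (i : ℤ) = b + 2 * ((i : ℤ) + 1) by ring, this]
      ring
    · intro i hi
      have := hold (i + 1) (by omega)
      push_cast at this
      rwa [show b + 2 + 2 * (i : ℤ) = b + 2 * ((i : ℤ) + 1) by ring]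

/-- The crossings at the vertices of tiles the lowest and the highest of which share only one of
their left vertices. -/
theorem flatMap_crossing_progression_grow (f : ℤ → ℕ) (b : ℤ) (n : ℕ)
    (hf : ∀ i ≤ n + 1, f (b + 2 * (i : ℤ)) = 2 * i) :
    ((progression 2 b (n + 2)).flatMap fun r =>
      (if r - 1 ∈ progression 2 (b + 1) (n + 1) then [Event.crossing (2 * f r - 1)] else []) ++
      (if r + 1 ∈ progression 2 (b + 1) (n + 1) then [Event.crossing (2 * f r + 1)] else [])) =
      crossings 0 (2 * (n + 1)) := by
  have e : progression 2 b (n + 2) =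
      b :: (progression 2 (b + 2) n ++ [b + 2 * ((n + 1 : ℕ) : ℤ)]) := by
    rw [progression, progression_add]
    simp [progression]
    ring
  have h1 := hf 0 (by omega)
  have h2 := hf (n + 1) (by omega)
  simp only [Nat.cast_zero, mul_zero, add_zero] at h1
  rw [e, List.flatMap_cons, List.flatMap_append, List.flatMap_singleton,
    flatMap_crossing_progression f _ 1, if_neg, if_pos, if_pos, if_neg, h1, h2]
  · rw [show 2 * (n + 1) = 1 + (2 * n + 1) by ring, crossings_add, crossings_add]
    simp [crossings]
    omega
  all_goals try simp only [mem_progression]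
  · rintro ⟨i, hi, h⟩
    push_cast at h
    omega
  · exact ⟨n, by omega, by push_cast; ring⟩
  · exact ⟨0, by omega, by simp⟩
  · rintro ⟨i, hi, h⟩
    omega
  · intro i hi
    have := hf (i + 1) (by omega)
    push_cast at this
    rw [show b + 2 + 2 * (i : ℤ) = b + 2 * ((i : ℤ) + 1) by ring, this]
    ring
  · intro i hi
    exact ⟨⟨i, by omega, by ring⟩, ⟨i + 1, by omega, by push_cast; ring⟩⟩

theorem leads_gridLine_start (b : ℤ) (n : ℕ) :
    Leads [] (gridLine [] (progression 2 b n)) (progression 2 (b - 1) n) 1 := by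
  have h : Leads [] (leftCusps 1 0 (b - 1) n) (progression 2 (b - 1) n) 1 :=
    leads_leftCusps_one (x := []) rfl (b - 1) n
  rw [← map_leftCusp_progression
    (fun r => tilesBelow [] r + tilesBelow (progression 2 b n) r) 1 0 b n] at h
  · have e : (progression 2 b n).flatMap (fun _ => ([] : List Event)) = [] := by simp
    simpa [gridLine, e] using h
  · intro i hi
    rw [tilesBelow_progression n (Or.inl rfl)]
    simp [tilesBelow]
    omega

theorem gridLine_grow (b : ℤ) (n : ℕ) :
    gridLine (progression 2 (b + 1) (n + 1)) (progression 2 b (n + 2)) =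
      leftCusps 2 0 (b - 1) (n + 2) ++ crossings 0 (2 * (n + 1)) ++ rightCusps 1 1 (n + 1) := by
  have hf (i : ℕ) (hi : i ≤ n + 1) : tilesBelow (progression 2 (b + 1) (n + 1)) (b + 2 * (i : ℤ)) +
      tilesBelow (progression 2 b (n + 2)) (b + 2 * (i : ℤ)) = 2 * i := by
    rw [tilesBelow_progression _ (Or.inl rfl), tilesBelow_progression (i := i) _ (Or.inr (by ring))]
    omega
  unfold gridLine
  congr 1
  · congr 1
    · exact map_leftCusp_progression _ _ _ _ _ fun i hi => by rw [hf i (by omega)]; ring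
    · exact flatMap_crossing_progression_grow (fun r =>
        tilesBelow (progression 2 (b + 1) (n + 1)) r + tilesBelow (progression 2 b (n + 2)) r) b n hf
  · refine map_rightCusp_progression _ _ _ _ _ fun i hi => ?_
    rw [tilesBelow_progression (i := i + 1) _ (Or.inr (by push_cast; ring))]
    omega

theorem gridLine_shrink (b : ℤ) (n : ℕ) :
    gridLine (progression 2 b (n + 2)) (progression 2 (b + 1) (n + 1)) =
      leftCusps 2 1 b (n + 1) ++ crossings 0 (2 * (n + 1)) ++ rightCusps 1 0 (n + 2) := by
  have hf (i : ℕ) (hi : i ≤ n) : tilesBelow (progression 2 b (n + 2)) (b + 1 + 2 * (i : ℤ)) +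
      tilesBelow (progression 2 (b + 1) (n + 1)) (b + 1 + 2 * (i : ℤ)) = 1 + 2 * i := by
    rw [tilesBelow_progression (i := i + 1) _ (Or.inr (by push_cast; ring)),
      tilesBelow_progression _ (Or.inl rfl)]
    omega
  unfold gridLine
  congr 1
  · congr 1
    · rw [map_leftCusp_progression (fun r => tilesBelow (progression 2 b (n + 2)) r +
        tilesBelow (progression 2 (b + 1) (n + 1)) r) 2 1 _ _ fun i hi => by rw [hf i (by omega)]]
      rw [add_sub_cancel_right]
    · refine flatMap_crossing_progression (fun r => tilesBelow (progression 2 b (n + 2)) r +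
        tilesBelow (progression 2 (b + 1) (n + 1)) r) _ 0 _ _
          (fun i hi => by rw [hf i (by omega), zero_add]) fun i hi => ?_
      simp only [mem_progression]
      exact ⟨⟨i, by omega, by ring⟩, ⟨i + 1, by omega, by push_cast; ring⟩⟩
  · refine map_rightCusp_progression _ _ _ _ _ fun i hi => ?_
    rw [tilesBelow_progression (i := i) _ (Or.inr (by ring))]
    omega

/-- All tiles of the left column share both of their right vertices. -/
theorem leads_gridLine_grow (b : ℤ) (n : ℕ) :
    Leads (progression 2 b (n + 1)) (gridLine (progression 2 (b + 1) (n + 1))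
      (progression 2 b (n + 2))) (progression 2 (b - 1) (n + 2)) 1 := by
  rw [gridLine_grow]
  have h0 : Leads (progression 2 b (n + 1)) [.leftCusp (2 * 0) (b - 1)]
      ([b - 1] ++ progression 2 b (n + 1) ++ []) 1 := by
    simpa using leads_leftCusp (x := []) (y := progression 2 b (n + 1)) rfl (b - 1)
  have h1 := h0.trans (leads_leftCusps_two (x := [b - 1]) rfl [] b (n + 1))
  have e : leftCusps 2 0 (b - 1) (n + 2) = [Event.leftCusp (2 * 0) (b - 1)] ++
      leftCusps 2 (1 + 1) (b + 1) (n + 1) := by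
    rw [leftCusps, show b - 1 + 2 = b + 1 by ring]
    rfl
  simp only [List.append_nil] at h1
  rw [e, List.append_assoc]
  refine h1.trans (c' := 1) fun G => ⟨fun hG => ?_, ?_⟩
  · rw [List.append_assoc]
    have h2 : IsFlatFrom (pairPotentials ([b - 1] ++ progression 1 b (2 * (n + 1)) ++ []))
        (rightCusps 1 1 (n + 1) ++ G) :=
      isFlatFrom_rightCusps_one rfl (by
        rw [progression, show b - 1 + 2 = b + 1 by ring] at hG
        simpa using hG)
    have e2 : [b - 1] ++ progression 1 b (2 * (n + 1)) =
        [] ++ progression 1 (b - 1) (2 * (n + 1) + 1) ++ [] := by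
      rw [List.append_nil, List.nil_append, progression, sub_add_cancel]
      rfl
    rw [List.append_nil] at h2
    rw [e2] at h2 ⊢
    exact isFlatFrom_crossings rfl h2
  · have := count_rightCusps_one (N := n + 2) (t := 0) (n + 1) 0 (by omega) G
    simp only [List.length_append, length_progression, List.length_singleton, one_mul,
      List.append_assoc]
    rw [show 1 + 2 * (n + 1) = n + 2 + (n + 1) by ring]
    simpa [crossings] using this

/-- All tiles of the right column share both of their left vertices. -/
theorem leads_gridLine_shrink (b : ℤ) (n : ℕ) :
    Leads (progression 2 (b - 1) (n + 2)) (gridLine (progression 2 b (n + 2))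
      (progression 2 (b + 1) (n + 1))) (progression 2 b (n + 1)) 1 := by
  rw [gridLine_shrink]
  have h1 := leads_leftCusps_two (x := []) rfl [b - 1 + 2 * (n + 1 : ℕ)] (b - 1) (n + 1)
  rw [sub_add_cancel, List.nil_append, List.nil_append] at h1
  have e0 : progression 2 (b - 1) (n + 2) =
      progression 2 (b - 1) (n + 1) ++ [b - 1 + 2 * (n + 1 : ℕ)] :=
    progression_add 2 (b - 1) (n + 1) 1
  rw [e0, List.append_assoc]
  refine h1.trans (c' := 1) fun G => ⟨fun hG => ?_, ?_⟩
  · rw [List.append_assoc, rightCusps_add 1 0 (n + 1) 1, List.append_assoc]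
    have h2 : IsFlatFrom (pairPotentials (progression 2 b (n + 1) ++ [b - 1 + 2 * (n + 1 : ℕ)]))
        (rightCusps 1 (0 + 1 * (n + 1)) 1 ++ G) :=
      isFlatFrom_rightCusp (by simp) (by simpa [rightCusps] using hG)
    have h3 : IsFlatFrom (pairPotentials
        ([] ++ progression 1 (b - 1) (2 * (n + 1)) ++ [b - 1 + 2 * (n + 1 : ℕ)])) _ :=
      isFlatFrom_rightCusps_one (n := n + 1) rfl (by rw [sub_add_cancel]; exact h2)
    have e2 : progression 1 (b - 1) (2 * (n + 1)) ++ [b - 1 + 2 * (n + 1 : ℕ)] =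
        [] ++ progression 1 (b - 1) (2 * (n + 1) + 1) ++ [] := by
      rw [progression_add]
      simp [progression]
    rw [List.nil_append] at h3
    rw [e2] at h3 ⊢
    exact isFlatFrom_crossings rfl h3
  · have h2 := count_crossings_bottom (N := 2 * n + 2) (t := 0) (by omega) (2 * n + 1)
      (rightCusps 1 1 (n + 1) ++ G)
    have h3 := count_rightCusps_one (N := n + 2) (t := 0) n 1 (by omega)
      (rightCusps 1 (1 + 1 * n) 1 ++ G)
    have h4 := count_pairing_top (N := n + 1) (t := n) (by omega) G
    simp only [List.length_append, length_progression, List.length_singleton, one_mul,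
      List.append_assoc]
    rw [rightCusps, show 2 * (n + 1) + 1 = 2 * n + 2 + 1 by ring, List.cons_append]
    refine h2.trans ?_
    rw [rightCusps_add 1 1 n 1, List.append_assoc, show 2 * n + 2 = n + 2 + n by ring]
    refine h3.trans (Eq.trans ?_ h4)
    rw [zero_add, one_mul, show 2 * n + 2 = 2 * (1 + n) by ring]
    rfl

/-- The line between the columns `3` and `4`, where the `q` lowest tiles end freely; for `q = 0` this
is an odd line of the checkerboard. -/
theorem leads_gridLine_drop (q : ℕ) :
    Leads (progression 2 (-(2 * (q : ℤ))) (q + 2))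
      (gridLine (progression 2 (1 - 2 * (q : ℤ)) (q + 2)) [2, 4]) [1, 3] 1 := by
  have e : gridLine (progression 2 (1 - 2 * (q : ℤ)) (q + 2)) [2, 4] =
      [.leftCusp (2 * (q + 1)) 1] ++ [.leftCusp (2 * (q + 3)) 3] ++
        (crossings q 3 ++ rightCusps 0 0 (q + 1) ++ [.rightCusp (2 * 1)]) := by
    have t2 : tilesBelow (progression 2 (1 - 2 * (q : ℤ)) (q + 2)) 2 = q + 1 := by
      rw [tilesBelow_progression (i := q + 1) _ (Or.inr (by push_cast; ring))]; omega
    have t4 : tilesBelow (progression 2 (1 - 2 * (q : ℤ)) (q + 2)) 4 = q + 2 := by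
      rw [tilesBelow_progression (i := q + 2) _ (Or.inr (by push_cast; ring))]; omega
    have n2 : tilesBelow [2, 4] 2 = 0 := rfl
    have n4 : tilesBelow [2, 4] 4 = 1 := rfl
    have m1 : (1 : ℤ) ∈ progression 2 (1 - 2 * (q : ℤ)) (q + 2) :=
      mem_progression.mpr ⟨q, by omega, by ring⟩
    have m3 : (3 : ℤ) ∈ progression 2 (1 - 2 * (q : ℤ)) (q + 2) :=
      mem_progression.mpr ⟨q + 1, by omega, by push_cast; ring⟩
    have m5 : (5 : ℤ) ∉ progression 2 (1 - 2 * (q : ℤ)) (q + 2) := by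
      rw [mem_progression]
      rintro ⟨i, hi, h⟩
      omega
    have hr : (progression 2 (1 - 2 * (q : ℤ)) (q + 2)).map
        (fun r => Event.rightCusp (2 * tilesBelow [2, 4] r)) =
        rightCusps 0 0 (q + 1) ++ [.rightCusp (2 * 1)] := by
      rw [progression_add 2 _ (q + 1) 1, List.map_append]
      congr 1
      · refine map_rightCusp_progression _ _ _ _ _ fun i hi => ?_
        simp only [tilesBelow, List.countP_cons, List.countP_nil, decide_eq_true_eq]
        rw [if_neg (by omega), if_neg (by omega)]
        omega
      · have e3 : 1 - 2 * (q : ℤ) + 2 * ((q + 1 : ℕ) : ℤ) = 3 := by push_cast; ring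
        rw [e3]
        rfl
    have a1 : (2 : ℤ) - 1 = 1 := rfl
    have a2 : (2 : ℤ) + 1 = 3 := rfl
    have a3 : (4 : ℤ) - 1 = 3 := rfl
    have a4 : (4 : ℤ) + 1 = 5 := rfl
    unfold gridLine
    rw [hr]
    simp only [List.map_cons, List.map_nil, List.flatMap_cons, List.flatMap_nil, t2, t4, n2, n4, a1,
      a2, a3, a4, m1, m3, m5, if_true, if_false, crossings]
    simp
    omega
  have e0 : progression 2 (-(2 * (q : ℤ))) (q + 2) = progression 2 (-(2 * (q : ℤ))) q ++ [0, 2] := by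
    rw [progression_add]
    simp [progression]
  have h1 := leads_leftCusp (x := progression 2 (-(2 * (q : ℤ))) q ++ [0]) (y := [2]) (t := q + 1)
    (by simp) 1
  have h2 := leads_leftCusp (x := progression 2 (-(2 * (q : ℤ))) q ++ [0, 1, 2]) (y := [])
    (t := q + 3) (by simp) 3
  simp only [List.append_assoc, List.cons_append, List.nil_append] at h1 h2
  rw [e, e0]
  refine (h1.trans h2).trans (c' := 1) fun G => ⟨fun hG => ?_, ?_⟩
  · have h3 : IsFlatFrom (pairPotentials ((progression 2 (-(2 * (q : ℤ))) q ++ [0]) ++ [1, 2, 3]))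
        (rightCusps 0 0 (progression 2 (-(2 * (q : ℤ))) q ++ [0]).length ++
          (.rightCusp (2 * 1) :: G)) :=
      isFlatFrom_rightCusps_zero (isFlatFrom_rightCusp (x := [1]) rfl hG)
    have h4 := isFlatFrom_crossings (x := progression 2 (-(2 * (q : ℤ))) q) (t := q) (by simp)
      (z := []) (h := 0) (m := 3) (by simpa [progression] using h3)
    simpa [progression] using h4
  · have h3 := count_rightCusps_zero (N := 4) q 3 (rightCusps 0 (0 + 0 * q) 1 ++ .rightCusp (2 * 1) :: G)
    have h4 := count_crossings_bottom (N := 3) (t := 0) (by omega) 2 (.rightCusp (2 * 1) :: G)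
    have h5 := count_crossings_middle (N := 2) (t := 0) (by omega) 0 G
    rw [rightCusps_add 0 0 q 1]
    simp only [List.length_append, length_progression, List.append_assoc, one_mul,
      List.length_cons, List.length_nil, List.cons_append, List.nil_append]
    rw [show q + (0 + 1 + 1 + 1 + 1) = 4 + q by ring]
    refine h3.trans (Eq.trans ?_ (h4.trans (h5.trans rfl)))
    simp [rightCusps]

/-- An even line of the checkerboard. -/
theorem leads_gridLine_even : Leads [1, 3] (gridLine [2, 4] [1, 3]) [0, 2] 1 := by
  have e : gridLine [2, 4] [1, 3] = [.leftCusp (2 * 0) 0] ++ [.leftCusp (2 * 2) 2] ++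
      (crossings 0 3 ++ [.rightCusp (2 * 1), .rightCusp (2 * 2)]) := by decide
  have h1 := leads_leftCusp (x := []) (y := [1, 3]) rfl 0
  have h2 := leads_leftCusp (x := [0, 1]) (y := [3]) rfl 2
  rw [e]
  refine (h1.trans h2).trans (c' := 1) fun G => ⟨fun hG => ?_, ?_⟩
  · rw [List.append_assoc]
    exact isFlatFrom_crossings (x := []) (t := 0) rfl (z := []) (h := 0) (m := 3)
      (isFlatFrom_rightCusp (x := [0]) (h := 1) rfl
        (isFlatFrom_rightCusp (x := [0, 2]) (h := 3) rfl hG))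
  · have h3 := count_crossings_middle (N := 3) (t := 0) (by omega) 1 (.rightCusp (2 * 2) :: G)
    have h4 := count_pairing_top (N := 2) (t := 1) (by omega) G
    rw [one_mul, List.append_assoc]
    exact h3.trans h4

theorem leads_gridLine_end : Leads [1, 3] (gridLine [2, 4] []) [] 1 :=
  (leads_rightCusp (x := []) (y := [3]) rfl 1).trans (leads_rightCusp (x := []) (y := []) rfl 3)

/-- The summand `1` turns the bottom edge of tile number `s`, of height `h + 2 * s`, into its row. -/
theorem leads_clasps (h : ℤ) (n : ℕ) (l : List ℕ) (hl : ∀ s ∈ l, s < n) :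
    Leads (progression 2 h n) (l.flatMap fun s => clasp (2 * s) (h + 2 * (s : ℤ) + 1))
      (progression 2 h n) (3 ^ l.length) := by
  induction l with
  | nil => exact Leads.refl _
  | cons s l ih =>
    rw [List.flatMap_cons, List.length_cons, pow_succ']
    refine Leads.trans ?_ (ih fun s hs => hl s (List.mem_cons_of_mem _ hs))
    obtain ⟨m, rfl⟩ := Nat.exists_eq_add_of_lt (hl s List.mem_cons_self)
    rw [add_assoc, progression_add, progression]
    exact leads_clasp (by simp) _

/-! ### The clasped checkerboards -/

theorem map_reverse_range_append_progression (a : ℤ) (n m : ℕ) :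
    (List.range n).reverse.map (fun j : ℕ => a - 2 * (j : ℤ)) ++ progression 2 (a + 2) m =
      progression 2 (a + 2 - 2 * (n : ℤ)) (n + m) := by
  rw [progression_add, show a + 2 - 2 * (n : ℤ) + 2 * n = a + 2 by ring]
  congr 1
  induction n with
  | zero => rfl
  | succ n ih =>
    rw [List.range_succ, List.reverse_append, List.map_append, ih, progression]
    simp only [List.reverse_singleton, List.map_singleton, List.singleton_append]
    push_cast
    rw [show a + 2 - 2 * ((n : ℤ) + 1) = a - 2 * n by ring,
      show a - 2 * (n : ℤ) + 2 = a + 2 - 2 * n by ring]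

/-- In `tileRows` the casts of the entries of `List.range` elaborate to a monadic lift of the whole
list; it is the entrywise cast. -/
theorem bind_pure_cast (l : List ℕ) :
    (do let a ← l; pure (a : ℤ)) = l.map (fun a : ℕ => (a : ℤ)) := by
  induction l with
  | nil => rfl
  | cons a l ih => exact congrArg _ ih

theorem tileRows_zero (g p : ℕ) : tileRows g p 0 = [] := by simp [tileRows]

theorem tileRows_two (g p : ℕ) (hg : 1 ≤ g) :
    tileRows g p 2 = progression 2 (2 - 2 * (p : ℤ)) (p + 2) := by
  have := map_reverse_range_append_progression 0 p 2
  simp only [zero_add, zero_sub] at this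
  rw [← this, tileRows, if_neg (by omega), if_pos rfl, bind_pure_cast, List.map_map]
  rfl

theorem tileRows_one_or_three (g q c : ℕ) (hg : 1 ≤ g) (hc : c = 1 ∨ c = 3) :
    tileRows g (q + 1) c = progression 2 (1 - 2 * (q : ℤ)) (q + 2) := by
  have := map_reverse_range_append_progression (-1) q 2
  rw [show (-1 : ℤ) + 2 = 1 by rfl] at this
  rw [← this, tileRows, if_neg (by omega), if_neg (by omega), if_pos hc, bind_pure_cast,
    List.map_map, Nat.add_sub_cancel]
  congr 1
  refine List.map_congr_left fun j _ => ?_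
  simp only [Function.comp_apply]
  ring

theorem tileRows_odd (g p c : ℕ) (hc : c % 2 = 1) (hcg : c ≤ 2 * g + 2) (hp : 4 ≤ c ∨ p = 0) :
    tileRows g p c = [1, 3] := by
  rw [tileRows, if_neg (by omega), if_neg (by omega)]
  split_ifs with h
  · obtain rfl : p = 0 := by omega
    rfl
  · rfl

theorem tileRows_even (g p c : ℕ) (hc : c % 2 = 0) (hcg : c ≤ 2 * g + 2) (hc4 : 4 ≤ c) :
    tileRows g p c = [2, 4] := by
  rw [tileRows, if_neg (by omega), if_neg (by omega), if_neg (by omega), if_neg (by omega)]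

theorem tileRows_right (g p : ℕ) : tileRows g p (2 * g + 3) = [] := by
  rw [tileRows, if_pos (by omega)]

/-- The first four grid lines and the clasps; column `4` belongs to the plain checkerboard. -/
theorem leads_left_columns (g p : ℕ) (hg : 1 ≤ g) :
    Leads [] (gridLine [] (tileRows g p 1) ++ (gridLine (tileRows g p 1) (tileRows g p 2) ++
      (List.range p).flatMap (fun s => clasp (2 * s) (-(2 * ((p : ℤ) - 1 - (s : ℤ)))))) ++
      gridLine (tileRows g p 2) (tileRows g p 3) ++ gridLine (tileRows g p 3) [2, 4])
      [1, 3] (3 ^ p) := by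
  rw [tileRows_two g p hg]
  cases p with
  | zero =>
    rw [tileRows_odd g 0 1 rfl (by omega) (Or.inr rfl), tileRows_odd g 0 3 rfl (by omega)
      (Or.inr rfl)]
    have h1 := leads_gridLine_start 1 2
    have h2 := leads_gridLine_drop 0
    exact ((h1.trans (h2.trans (Leads.refl _))).trans leads_gridLine_even).trans h2
  | succ q =>
    rw [tileRows_one_or_three g q 1 hg (Or.inl rfl), tileRows_one_or_three g q 3 hg (Or.inr rfl)]
    have h1 := leads_gridLine_start (1 - 2 * (q : ℤ)) (q + 2)
    have h2 := leads_gridLine_grow (-(2 * (q : ℤ))) (q + 1)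
    have h3 := leads_clasps (-(2 * (q : ℤ)) - 1) (q + 3) (List.range (q + 1)) (fun s hs => by
      rw [List.mem_range] at hs
      omega)
    have h4 := leads_gridLine_shrink (-(2 * (q : ℤ))) (q + 1)
    have h5 := leads_gridLine_drop q
    rw [show 1 - 2 * (q : ℤ) - 1 = -(2 * (q : ℤ)) by ring] at h1
    rw [show -(2 * (q : ℤ)) + 1 = 1 - 2 * (q : ℤ) by ring] at h2 h4
    have e : (fun s : ℕ => clasp (2 * s) (-(2 * (((q + 1 : ℕ) : ℤ) - 1 - (s : ℤ))))) =
        fun s : ℕ => clasp (2 * s) (-(2 * (q : ℤ)) - 1 + 2 * (s : ℤ) + 1) := by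
      funext s
      congr 1
      push_cast
      ring
    rw [e, show 2 - 2 * ((q + 1 : ℕ) : ℤ) = -(2 * (q : ℤ)) by push_cast; ring]
    simpa using ((h1.trans (h2.trans h3)).trans h4).trans h5

theorem leads_claspedCheckerboard (g p : ℕ) (hg : 1 ≤ g) :
    Leads [] (claspedCheckerboard g p) [] (3 ^ p) := by
  obtain ⟨k, rfl⟩ := Nat.exists_eq_add_of_le' hg
  unfold claspedCheckerboard
  set f : ℕ → Front := fun c => gridLine (tileRows (k + 1) p c) (tileRows (k + 1) p (c + 1)) ++
      if c = 1 then
        (List.range p).flatMap (fun s => clasp (2 * s) (-(2 * ((p : ℤ) - 1 - (s : ℤ)))))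
      else [] with hf
  have hmid (j : ℕ) (hj : j ≤ k) :
      Leads [1, 3] (((List.range (2 * j)).map (4 + ·)).flatMap f) [1, 3] 1 := by
    induction j with
    | zero => exact Leads.refl _
    | succ j ih =>
      have h0 : f (4 + 2 * j) = gridLine [2, 4] [1, 3] := by
        simp only [hf]
        rw [tileRows_even _ _ (4 + 2 * j) (by omega) (by omega) (by omega),
          tileRows_odd _ _ _ (by omega) (by omega) (by omega), if_neg (by omega), List.append_nil]
      have h1 : f (4 + (2 * j + 1)) = gridLine [1, 3] [2, 4] := by
        simp only [hf]
        rw [tileRows_odd _ _ (4 + (2 * j + 1)) (by omega) (by omega) (by omega),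
          tileRows_even _ _ _ (by omega) (by omega) (by omega), if_neg (by omega), List.append_nil]
      have := ((ih (by omega)).trans leads_gridLine_even).trans (leads_gridLine_drop 0)
      simp only [Nat.mul_succ, List.range_succ, List.map_append, List.flatMap_append,
        List.map_singleton, List.flatMap_singleton, h0, h1]
      simpa [progression] using this
  have hlast : f (4 + 2 * k) = gridLine [2, 4] [] := by
    simp only [hf]
    rw [tileRows_even _ _ (4 + 2 * k) (by omega) (by omega) (by omega),
      show 4 + 2 * k + 1 = 2 * (k + 1) + 3 by ring, tileRows_right, if_neg (by omega),
      List.append_nil]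
  have hfirst := leads_left_columns (k + 1) p hg
  have e4 : tileRows (k + 1) p 4 = [2, 4] := tileRows_even _ _ 4 rfl (by omega) le_rfl
  have e : (List.range 4).flatMap f = gridLine [] (tileRows (k + 1) p 1) ++
      (gridLine (tileRows (k + 1) p 1) (tileRows (k + 1) p 2) ++
      (List.range p).flatMap (fun s => clasp (2 * s) (-(2 * ((p : ℤ) - 1 - (s : ℤ)))))) ++
      gridLine (tileRows (k + 1) p 2) (tileRows (k + 1) p 3) ++
      gridLine (tileRows (k + 1) p 3) [2, 4] := by
    simp [List.range_succ, hf, tileRows_zero, e4]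
  rw [← e] at hfirst
  have := (hfirst.trans (hmid k le_rfl)).trans leads_gridLine_end
  rw [show 2 * (k + 1) + 3 = 4 + (2 * k + 1) by ring, List.range_add,
    List.range_succ (n := 2 * k), List.map_append, List.flatMap_append, List.flatMap_append, List.map_singleton,
    List.flatMap_singleton, hlast, ← List.append_assoc]
  simpa using this

end LegendrianFront

theorem mainTheorem10 (g p : ℕ) (hg : 1 ≤ g) :
    (LegendrianFront.claspedCheckerboard g p).IsClosed ∧
    Equivalence (LegendrianFront.AugEquiv (LegendrianFront.claspedCheckerboard g p)) ∧
    Nat.card (Quot (LegendrianFront.AugEquiv (LegendrianFront.claspedCheckerboard g p))) = 3 ^ p := by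
  open LegendrianFront in
  obtain ⟨h1, h2⟩ := leads_claspedCheckerboard g p hg []
  rw [List.append_nil] at h1 h2
  have h : IsFlatFrom [] (claspedCheckerboard g p) := h1 rfl
  refine ⟨h.isClosed, ?_, ?_⟩
  · rw [h.augEquiv_eq]
    exact eq_equivalence
  · rw [card_quot_augEquiv h, ← pairing_zero]
    simpa [count] using h2
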